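/- Let $p$ be an odd prime, let $V=\mathbb F_p^2$ with basis $v_1,v_2$, and let $G\subset \mathrm{GL}(V)$ be the cyclic group of order $p$ generated by $g=\begin{pmatrix}1&1\\0&1\end{pmatrix}$, so that ${}^gv_1=v_1$ and ${}^gv_2=v_1+v_2$. Given $\mathbb F_p$-bilinear maps $\lambda:\mathbb F_pG\times V\to\mathbb F_pG$ and $\kappa:V\times V\to \mathbb F_pG\oplus(V\otimes\mathbb F_pG)$, let $\mathcal H_{\lambda,\kappa}$ be the quotient of the free product $T(V)*\mathbb F_pG$ of the tensor algebra and the group algebra by the ideal generated by $$hv-{}^hv\,h-\lambda(h,v),\qquad vw-wv-\kappa(v,w)\qquad(h\in G,\ v,w\in V).$$ It is filtered by degree, with elements of $V$ in degree $1$ and elements of $G$ in degree $0$. It is called a Drinfeld orbifold algebra if its associated graded algebra is isomorphic to the skew group algebra $S(V)\rtimes G$ as a graded algebra. There are exactly $p^{3p+1}$ Drinfeld orbifold algebras $\mathcal H_{\lambda,\kappa}$: there are exactly $p^{3p+1}$ pairs $(\lambda,\kappa)$ for which $\mathcal H_{\lambda,\kappa}$ is a Drinfeld orbifold algebra, and different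 such pairs define different quotients. They are precisely the algebras given by the following procedure. Choose $k\in\{0,\dots,p\}$ and $b=\sum_{j=0}^{p-1}b_jg^j\in\mathbb F_pG$ of the form $b=(g-1)^k\tilde b$ with $\tilde b=\sum_j\tilde b_jg^j\in\mathbb F_pG$, $\sum_j\tilde b_j\ne0$; choose $d_1,\dots,d_k\in\mathbb F_p$, an $\mathbb F_p$-linear map $f:V\to\mathbb F_pG$, $f(v)=\sum_{j=0}^{p-1}f_j(v)g^j$, and $\kappa^C\in\mathbb F_pG$. For $0\le j\le p-1$ put $$\mu(\mathbf d,j)=(-1)^{p-j}\sum_{m=1}^{k}(-1)^{m+1}\binom{p-m}{p-j}d_m .$$ Let $\lambda$ be the bilinear map and $\kappa$ the alternating bilinear map such that, for $0\le i\le p-1$, $$\lambda(g^i,v_1)=i\,b\,g^i,$$ $$\lambda(g^i,v_2)=\sum_{j=0}^{p-1}\left(\binom i2+i\,j^{p-2}\binom{j+1}2\right)b_jg^{i+j}+i\sum_{j=0}^{p-1}j^{p-2}\mu(\mathbf d,j)g^{i+j}-i\left(\sum_{j=0}^{p-1}f_j(v_1)g^j\right)g^i,$$ $$\kappa(v_1,v_2)=\left(\sum_{m=1}^{k}(-1)^{m+1}d_m\right)v_1+\sum_{j=0}^{p-1}j\,b_j\,v_2g^j+\kappa^C+\sum_{j=0}^{p-1}j\,f_j(v_1)\,v_1g^j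 .$$ -/

import Mathlib

open scoped TensorProduct DirectSum

noncomputable section

namespace DrinfeldOrbifold

/-! ### The associated graded algebra of an increasing filtration -/

section AssociatedGraded

variable {F A : Type*} [Field F] [Ring A] [Algebra F A]

/-- The preceding step of a filtration `Fil 0 ⊆ Fil 1 ⊆ ⋯` (it is zero below `Fil 0`). -/
def prevStep (Fil : ℕ → Submodule F A) : ℕ → Submodule F A
  | 0 => ⊥
  | n + 1 => Fil n

/-- The degree `n` component `Fil n / Fil (n - 1)` of the associated graded algebra. -/
def GrPiece (Fil : ℕ → Submodule F A) (n : ℕ) : Type _ :=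
  Fil n ⧸ (prevStep Fil n).submoduleOf (Fil n)

variable (Fil : ℕ → Submodule F A)

instance (n : ℕ) : AddCommGroup (GrPiece Fil n) :=
  inferInstanceAs (AddCommGroup (Fil n ⧸ (prevStep Fil n).submoduleOf (Fil n)))

instance (n : ℕ) : Module F (GrPiece Fil n) :=
  inferInstanceAs (Module F (Fil n ⧸ (prevStep Fil n).submoduleOf (Fil n)))

/-- The class in `Fil n / Fil (n - 1)` of an element of `Fil n`. -/
def grMk (n : ℕ) : Fil n →ₗ[F] GrPiece Fil n :=
  ((prevStep Fil n).submoduleOf (Fil n)).mkQ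

theorem grMk_surjective (n : ℕ) : Function.Surjective (grMk Fil n) :=
  Submodule.mkQ_surjective _

theorem grMk_eq_zero {n : ℕ} (x : Fil n) : grMk Fil n x = 0 ↔ (x : A) ∈ prevStep Fil n := by
  exact Submodule.Quotient.mk_eq_zero ((prevStep Fil n).submoduleOf (Fil n))

theorem gradedMk_eq {i j : ℕ} (h : i = j) (x : Fil i) (y : Fil j) (hxy : (x : A) = y) :
    GradedMonoid.mk i (grMk Fil i x) = GradedMonoid.mk j (grMk Fil j y) := by
  subst h
  rw [Subtype.ext hxy]

variable [SetLike.GradedMonoid Fil]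

/-- Multiplication `Fil i × Fil j → Fil (i + j)`. -/
def filMul (i j : ℕ) : Fil i →ₗ[F] Fil j →ₗ[F] Fil (i + j) :=
  LinearMap.mk₂ F (fun x y => ⟨(x : A) * (y : A), SetLike.mul_mem_graded x.2 y.2⟩)
    (fun _ _ _ => Subtype.ext (add_mul _ _ _))
    (fun c _ _ => Subtype.ext (smul_mul_assoc c _ _))
    (fun _ _ _ => Subtype.ext (mul_add _ _ _))
    (fun c _ _ => Subtype.ext (mul_smul_comm c _ _))

theorem prevStep_mul_left {i j : ℕ} {x y : A} (hx : x ∈ prevStep Fil i) (hy : y ∈ Fil j) :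
    x * y ∈ prevStep Fil (i + j) := by
  cases i with
  | zero =>
    have h0 : x = 0 := by simpa [prevStep] using hx
    simp [h0]
  | succ n =>
    have h : n + 1 + j = (n + j) + 1 := by omega
    rw [h]
    exact SetLike.mul_mem_graded (A := Fil) hx hy

theorem prevStep_mul_right {i j : ℕ} {x y : A} (hx : x ∈ Fil i) (hy : y ∈ prevStep Fil j) :
    x * y ∈ prevStep Fil (i + j) := by
  cases j with
  | zero =>
    have h0 : y = 0 := by simpa [prevStep] using hy
    simp [h0]
  | succ n => exact SetLike.mul_mem_graded (A := Fil) hx hy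

/-- Multiplication `Fil i / Fil (i - 1) × Fil j / Fil (j - 1) → Fil (i + j) / Fil (i + j - 1)`,
induced by that of `A`. -/
def grMul (i j : ℕ) : GrPiece Fil i →ₗ[F] GrPiece Fil j →ₗ[F] GrPiece Fil (i + j) :=
  Submodule.liftQ _
    (LinearMap.flip
      (Submodule.liftQ _
        (LinearMap.flip ((filMul Fil i j).compr₂ (grMk Fil (i + j))))
        (fun y hy => LinearMap.ext fun x =>
          (grMk_eq_zero Fil _).2 (prevStep_mul_right Fil x.2 hy))))
    (fun x hx => LinearMap.ext fun b => by
      obtain ⟨y, rfl⟩ := grMk_surjective Fil j b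
      exact (grMk_eq_zero Fil _).2 (prevStep_mul_left Fil hx y.2))

theorem grMul_mk {i j : ℕ} (x : Fil i) (y : Fil j) :
    grMul Fil i j (grMk Fil i x) (grMk Fil j y) =
      grMk Fil (i + j) ⟨(x : A) * (y : A), SetLike.mul_mem_graded x.2 y.2⟩ :=
  rfl

instance : GradedMonoid.GMul (GrPiece Fil) where
  mul a b := grMul Fil _ _ a b

instance : GradedMonoid.GOne (GrPiece Fil) where
  one := grMk Fil 0 ⟨1, SetLike.one_mem_graded Fil⟩

instance : GradedMonoid.GMonoid (GrPiece Fil) where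
  one_mul := by
    rintro ⟨i, a⟩
    obtain ⟨x, rfl⟩ := grMk_surjective Fil i a
    exact gradedMk_eq Fil (zero_add i) _ _ (one_mul _)
  mul_one := by
    rintro ⟨i, a⟩
    obtain ⟨x, rfl⟩ := grMk_surjective Fil i a
    exact gradedMk_eq Fil (add_zero i) _ _ (mul_one _)
  mul_assoc := by
    rintro ⟨i, a⟩ ⟨j, b⟩ ⟨k, c⟩
    obtain ⟨x, rfl⟩ := grMk_surjective Fil i a
    obtain ⟨y, rfl⟩ := grMk_surjective Fil j b
    obtain ⟨z, rfl⟩ := grMk_surjective Fil k c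
    exact gradedMk_eq Fil (add_assoc i j k) _ _ (mul_assoc _ _ _)

instance : DirectSum.GSemiring (GrPiece Fil) where
  mul_zero {i j} a := map_zero (grMul Fil i j a)
  zero_mul {i j} b := LinearMap.map_zero₂ (grMul Fil i j) b
  mul_add {i j} a b c := map_add (grMul Fil i j a) b c
  add_mul {i j} a b c := LinearMap.map_add₂ (grMul Fil i j) a b c
  natCast n := n • grMk Fil 0 ⟨1, SetLike.one_mem_graded Fil⟩
  natCast_zero := zero_smul _ _
  natCast_succ n := succ_nsmul _ n

instance : DirectSum.GAlgebra F (GrPiece Fil) where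
  toFun :=
    { toFun := fun r => r • grMk Fil 0 ⟨1, SetLike.one_mem_graded Fil⟩
      map_zero' := zero_smul _ _
      map_add' := fun r s => add_smul r s _ }
  map_one := one_smul _ _
  map_mul r s := by
    exact gradedMk_eq Fil (add_zero 0).symm ((r * s) • ⟨1, SetLike.one_mem_graded Fil⟩)
      ⟨(r • (1 : A)) * (s • (1 : A)), SetLike.mul_mem_graded
        ((Fil 0).smul_mem r (SetLike.one_mem_graded Fil))
        ((Fil 0).smul_mem s (SetLike.one_mem_graded Fil))⟩ (by simp [mul_smul, smul_comm r s])
  commutes r := by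
    rintro ⟨i, a⟩
    obtain ⟨x, rfl⟩ := grMk_surjective Fil i a
    exact gradedMk_eq Fil (by omega : 0 + i = i + 0)
      ⟨(r • (1 : A)) * (x : A), SetLike.mul_mem_graded
        ((Fil 0).smul_mem r (SetLike.one_mem_graded Fil)) x.2⟩
      ⟨(x : A) * (r • (1 : A)), SetLike.mul_mem_graded x.2
        ((Fil 0).smul_mem r (SetLike.one_mem_graded Fil))⟩ (by simp)
  smul_def r := by
    rintro ⟨i, a⟩
    obtain ⟨x, rfl⟩ := grMk_surjective Fil i a
    exact gradedMk_eq Fil (zero_add i).symm (r • x)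
      ⟨(r • (1 : A)) * (x : A), SetLike.mul_mem_graded
        ((Fil 0).smul_mem r (SetLike.one_mem_graded Fil)) x.2⟩ (by simp)

end AssociatedGraded

/-! ### The skew group algebra of the symmetric algebra -/

section SkewGroupAlgebra

variable (F V G : Type*) [Field F] [AddCommGroup V] [Module F V] [Group G]
  [DistribMulAction G V] [SMulCommClass G F V]

variable {V G} in
/-- The automorphism of `S(V)` which extends the action of `h` on `V`. -/
def symAct (h : G) : SymmetricAlgebra F V →ₐ[F] SymmetricAlgebra F V :=
  SymmetricAlgebra.lift (SymmetricAlgebra.ι F V ∘ₗ DistribSMul.toLinearMap F V h)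

theorem symAct_one : symAct F (1 : G) = AlgHom.id F (SymmetricAlgebra F V) := by
  apply SymmetricAlgebra.algHom_ext
  ext v
  simp [symAct]

theorem symAct_mul (h k : G) :
    symAct F (h * k) = ((symAct F h).comp (symAct F k) :
      SymmetricAlgebra F V →ₐ[F] SymmetricAlgebra F V) := by
  apply SymmetricAlgebra.algHom_ext
  ext v
  simp [symAct, mul_smul]

/-- The action of `G` on `S(V)` by algebra automorphisms. -/
instance : MulSemiringAction G (SymmetricAlgebra F V) where
  smul h x := symAct F h x
  one_smul x := by
    change symAct F (1 : G) x = x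
    rw [symAct_one]
    rfl
  mul_smul h k x := by
    change symAct F (h * k) x = symAct F h (symAct F k x)
    rw [symAct_mul]
    rfl
  smul_zero h := map_zero (symAct F h)
  smul_add h := map_add (symAct F h)
  smul_one h := map_one (symAct F h)
  smul_mul h := map_mul (symAct F h)

instance : SMulCommClass G F (SymmetricAlgebra F V) where
  smul_comm h c x := map_smul (symAct F h) c x

/-- The skew group algebra `S(V) ⋊ G`, with `(a ⊗ h) (a' ⊗ h') = a (h • a') ⊗ h h'`. -/
abbrev SkewGroupAlgebra : Type _ := SkewMonoidAlgebra (SymmetricAlgebra F V) G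

/-- The degree `n` component `Sⁿ(V) ⊗ F[G]` of `S(V) ⋊ G`. -/
def skewDegree (n : ℕ) : Submodule F (SkewGroupAlgebra F V G) where
  carrier := {x | ∀ h : G, x.coeff h ∈ (LinearMap.range (SymmetricAlgebra.ι F V)) ^ n}
  zero_mem' h := by simp
  add_mem' hx hy h := by
    rw [SkewMonoidAlgebra.coeff_add]
    exact Submodule.add_mem _ (hx h) (hy h)
  smul_mem' c x hx h := by
    rw [SkewMonoidAlgebra.coeff_smul]
    exact Submodule.smul_mem _ c (hx h)

end SkewGroupAlgebra

/-! ### The algebras `H_{λ,κ}` -/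

section Quotient

variable (F V G : Type*) [Field F] [AddCommGroup V] [Module F V] [Group G]
  [DistribMulAction G V] [SMulCommClass G F V]

/-- A pair of parameter functions: bilinear maps `λ : F[G] × V → F[G]` and
`κ : V × V → F[G] ⊕ (V ⊗ F[G])`. -/
@[ext]
structure Params where
  lam : MonoidAlgebra F G →ₗ[F] V →ₗ[F] MonoidAlgebra F G
  kap : V →ₗ[F] V →ₗ[F] (MonoidAlgebra F G × (V ⊗[F] MonoidAlgebra F G))

/-- The free algebra generated by the vector space `V ⊕ F[G]`. -/
abbrev Words : Type _ := TensorAlgebra F (V × MonoidAlgebra F G)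

/-- A vector as a generator. -/
def vec : V →ₗ[F] Words F V G :=
  TensorAlgebra.ι F ∘ₗ LinearMap.inl F V (MonoidAlgebra F G)

/-- An element of the group algebra as a generator. -/
def grp : MonoidAlgebra F G →ₗ[F] Words F V G :=
  TensorAlgebra.ι F ∘ₗ LinearMap.inr F V (MonoidAlgebra F G)

/-- `F[G] ⊕ (V ⊗ F[G])` in the free algebra, via `(x, v ⊗ y) ↦ x + v y`. -/
def lowDegree : (MonoidAlgebra F G × (V ⊗[F] MonoidAlgebra F G)) →ₗ[F] Words F V G :=
  (grp F V G).coprod (TensorProduct.lift ((LinearMap.mul F (Words F V G)).compl₁₂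
    (vec F V G) (grp F V G)))

variable {F V G}

/-- The defining relations of `H_{λ,κ}`. The relations `one` and `mul` alone present the free
product of the tensor algebra `T(V)` and the group algebra `F[G]`. -/
inductive Rel (P : Params F V G) : Words F V G → Words F V G → Prop
  | one : Rel P (grp F V G 1) 1
  | mul (x y : MonoidAlgebra F G) : Rel P (grp F V G (x * y)) (grp F V G x * grp F V G y)
  | cross (h : G) (v : V) :
      Rel P (grp F V G (MonoidAlgebra.of F G h) * vec F V G v)
        (vec F V G (h • v) * grp F V G (MonoidAlgebra.of F G h) +
          grp F V G (P.lam (MonoidAlgebra.of F G h) v))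
  | comm (v w : V) :
      Rel P (vec F V G v * vec F V G w)
        (vec F V G w * vec F V G v + lowDegree F V G (P.kap v w))

/-- The algebra `H_{λ,κ}`. -/
abbrev H (P : Params F V G) : Type _ := RingQuot (Rel P)

/-- The quotient map from the free algebra onto `H_{λ,κ}`. -/
def toH (P : Params F V G) : Words F V G →ₐ[F] H P := RingQuot.mkAlgHom F (Rel P)

/-- A letter of degree one (a vector) or of degree zero (an element of the group algebra). -/
def letter (P : Params F V G) : V ⊕ MonoidAlgebra F G → H P :=
  Sum.elim (fun v => toH P (vec F V G v)) (fun x => toH P (grp F V G x))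

/-- The filtration of `H_{λ,κ}` by degree: the span of all products of generators in which at
most `n` factors are vectors. -/
def filtration (P : Params F V G) (n : ℕ) : Submodule F (H P) :=
  Submodule.span F
    {x | ∃ l : List (V ⊕ MonoidAlgebra F G),
      l.countP Sum.isLeft ≤ n ∧ (l.map (letter P)).prod = x}

instance (P : Params F V G) : SetLike.GradedMonoid (filtration P) where
  one_mem := Submodule.subset_span ⟨[], by simp, by simp⟩
  mul_mem i j x y hx hy := by
    have h := Submodule.mul_mem_mul hx hy
    unfold filtration at h
    rw [Submodule.span_mul_span] at h
    refine Submodule.span_mono ?_ h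
    rintro _ ⟨_, ⟨l, hl, rfl⟩, _, ⟨m, hm, rfl⟩, rfl⟩
    exact ⟨l ++ m, by rw [List.countP_append]; omega, by simp⟩

/-- `H_{λ,κ}` is a Drinfeld orbifold algebra: its associated graded algebra is isomorphic to
`S(V) ⋊ G` as a graded algebra. -/
def IsDrinfeldOrbifoldAlgebra (P : Params F V G) : Prop :=
  ∃ e : (⨁ n, GrPiece (filtration P) n) ≃ₐ[F] SkewGroupAlgebra F V G,
    ∀ n : ℕ, (LinearMap.range (DirectSum.lof F ℕ (GrPiece (filtration P)) n)).map
      e.toLinearMap = skewDegree F V G n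

end Quotient

/-! ### The cyclic transvection group acting on the plane -/

section Transvection

variable (p : ℕ) [Fact p.Prime]

/-- `V = 𝔽_p²`. -/
abbrev Plane : Type := Fin 2 → ZMod p

/-- The basis vector `v₁`. -/
def v₁ : Plane p := Pi.single 0 1

/-- The basis vector `v₂`. -/
def v₂ : Plane p := Pi.single 1 1

/-- The transvection with matrix `(1 1; 0 1)`. -/
def transvection : LinearMap.GeneralLinearGroup (ZMod p) (Plane p) :=
  Matrix.GeneralLinearGroup.toLin
    (Matrix.GeneralLinearGroup.mkOfDetNeZero !![1, 1; 0, 1] (by simp))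

/-- The cyclic group generated by the transvection. -/
abbrev Grp : Type := Subgroup.zpowers (transvection p)

/-- The action `h • v = h v` of the group on `V`. -/
instance : SMul (Grp p) (Plane p) where
  smul h v := ((h : LinearMap.GeneralLinearGroup (ZMod p) (Plane p)) : Plane p →ₗ[ZMod p] Plane p) v

instance : DistribMulAction (Grp p) (Plane p) where
  one_smul _ := rfl
  mul_smul _ _ _ := rfl
  smul_zero h := map_zero ((h : LinearMap.GeneralLinearGroup (ZMod p) (Plane p)) :
    Plane p →ₗ[ZMod p] Plane p)
  smul_add h := map_add ((h : LinearMap.GeneralLinearGroup (ZMod p) (Plane p)) :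
    Plane p →ₗ[ZMod p] Plane p)

instance : SMulCommClass (Grp p) (ZMod p) (Plane p) where
  smul_comm h := map_smul ((h : LinearMap.GeneralLinearGroup (ZMod p) (Plane p)) :
    Plane p →ₗ[ZMod p] Plane p)

/-- The generator `g` of the group. -/
def gen : Grp p := ⟨transvection p, Subgroup.mem_zpowers _⟩

/-- The group algebra `𝔽_p G`. -/
abbrev GrpAlg : Type := MonoidAlgebra (ZMod p) (Grp p)

/-- The element `g ^ i` of the group algebra. -/
def gpow (i : ℕ) : GrpAlg p := MonoidAlgebra.of (ZMod p) (Grp p) (gen p ^ i)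

variable {p}

/-- The coefficient of `g ^ j`. -/
def coef (x : GrpAlg p) (j : ℕ) : ZMod p := x.coeff (gen p ^ j)

/-- `μ(d, j) = (-1)^(p-j) ∑_{m=1}^{k} (-1)^(m+1) C(p-m, p-j) d_m`, for `d = (d_1, …, d_k)`; the
entry `d_m` is `d (m - 1)` here. -/
def mu {k : ℕ} (d : Fin k → ZMod p) (j : ℕ) : ZMod p :=
  (-1) ^ (p - j) *
    ∑ m : Fin k, (-1) ^ (m : ℕ) * ((p - (m + 1)).choose (p - j) : ZMod p) * d m

/-- `(λ, κ)` is the pair of parameter functions given by the data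
`b`, `d = (d_1, …, d_k)`, `f`, `κ^C`. -/
structure IsGivenBy (P : Params (ZMod p) (Plane p) (Grp p)) (b : GrpAlg p) {k : ℕ}
    (d : Fin k → ZMod p) (f : Plane p →ₗ[ZMod p] GrpAlg p) (κC : GrpAlg p) : Prop where
  lam_v₁ : ∀ i < p, P.lam (gpow p i) (v₁ p) = (i : ZMod p) • (b * gpow p i)
  lam_v₂ : ∀ i < p, P.lam (gpow p i) (v₂ p) =
    ∑ j ∈ Finset.range p,
        (((i.choose 2 : ZMod p) + i * (j : ZMod p) ^ (p - 2) * ((j + 1).choose 2 : ZMod p)) *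
          coef b j) • gpow p (i + j)
      + (i : ZMod p) • ∑ j ∈ Finset.range p, ((j : ZMod p) ^ (p - 2) * mu d j) • gpow p (i + j)
      - (i : ZMod p) • ((∑ j ∈ Finset.range p, coef (f (v₁ p)) j • gpow p j) * gpow p i)
  kap_self : ∀ v, P.kap v v = 0
  kap_v₁_v₂ : P.kap (v₁ p) (v₂ p) =
    (κC,
      (∑ m : Fin k, (-1) ^ (m : ℕ) * d m) • (v₁ p ⊗ₜ[ZMod p] gpow p 0)
        + ∑ j ∈ Finset.range p, ((j : ZMod p) * coef b j) • (v₂ p ⊗ₜ[ZMod p] gpow p j)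
        + ∑ j ∈ Finset.range p, ((j : ZMod p) * coef (f (v₁ p)) j) • (v₁ p ⊗ₜ[ZMod p] gpow p j))

/-- `b = (g - 1)^k b̃` for some `b̃` with nonzero coefficient sum. -/
def HasOrder (b : GrpAlg p) (k : ℕ) : Prop :=
  ∃ b' : GrpAlg p, b = (gpow p 1 - 1) ^ k * b' ∧ ∑ j ∈ Finset.range p, coef b' j ≠ 0

end Transvection

end DrinfeldOrbifold

end

open DrinfeldOrbifold

/-!
Write `A = 𝔽_p G`, which is commutative, let `E` be the Euler derivation `h ↦ e(h) h` of `A`, where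
`h v₂ = e(h) v₁ + v₂`, and put `q = E (E - 1) / 2`.

*Being a Drinfeld orbifold algebra is a PBW property.* There is always a canonical graded surjection
`S(V) ⋊ G → gr H_{λ,κ}` (`toGr`). As the graded pieces have finite dimension, an abstract graded
isomorphism forces it to be injective (`isDrinfeldOrbifoldAlgebra_iff`). In particular the space
`F[G] ⊕ (V ⊗ F[G])` embeds into a Drinfeld orbifold algebra (`hlow_injective`), so that `λ` and `κ`
can be read off from the relations (`injOn_ker_toH`).

*Necessary conditions.* Comparing the two ways of moving `v₁` and `v₂` past a product in `A` shows
that `λ(-, v₁)` is a derivation of `A`, hence equal to `b E` for some `b`, and that `λ(-, v₂) - b q`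
is a derivation, hence equal to `c E` for some `c`. If `κ(v₁, v₂) = κ^C + v₁ α + v₂ β`, then the two
ways of reordering `g v₁ v₂` show that `β = E(b)` and `b z = 0` for `z = α + E(c) - q(b) - E(b)`
(`overlap`). So the parameter functions are `stdParams b c α κC` with `b z = 0`
(`exists_eq_stdParams`).

*Sufficiency.* If `b z = 0`, then the algebra is an iterated skew polynomial extension of `A`. The
first step is `A[x; δ]` with `δ = b E`, and `y w = σ(w) y + D(w)` in the second one. The pair
`(σ, D)` is encoded by a homomorphism `w ↦ (σ(w), D(w); 0, w)` to matrices (`skewMat`), which exists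
because `b z = 0` (`skewMat_cross`). The resulting action of `H_{λ,κ}` on series in `y` over
`A[x; δ]` separates the monomials `a v₁ⁱ v₂ʲ` (`hCoeff_monomial`), which gives the PBW property
(`isDrinfeldOrbifoldAlgebra_stdParams`).

*Comparison with the given formulas.* Put `u = 1 - g⁻¹`, so that `A` is the truncated polynomial
algebra in `u` with `uᵖ = 0`. The formulas describe `stdParams b c α κC` for a pair `(c, α)` with
`z = ∑ (-1)^(m+1) d_m u^(p-m)` (`data_condition`), since the binomial sums `μ(d, j)` are the
coefficients of this element (`powSum_unip`). If `b` has order `k` with respect to `g - 1`, these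
elements `z` form exactly the annihilator of `b` (`mul_eq_zero_iff_powSum`).

*The count.* The parameter functions correspond to quadruples `(b, z, c, κ^C)` with `b z = 0`. An
element of order `k` has an annihilator with `p ^ k` elements, so there are
`p ^ p + p (p - 1) p ^ (p - 1) = p ^ (p + 1)` pairs `(b, z)` (`card_mul_eq_zero`), and `p ^ p` choices
of each of `c` and `κ^C`.
-/

noncomputable section

set_option linter.unusedSectionVars false

namespace DrinfeldOrbifold

section PBW

variable {F V G : Type*} [Field F] [AddCommGroup V] [Module F V] [Group G]
  [DistribMulAction G V] [SMulCommClass G F V]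

/-! ### Generators of `H_{λ,κ}` -/

/-- The map `V → H_{λ,κ}`. -/
def hvec (P : Params F V G) : V →ₗ[F] H P := (toH P).toLinearMap ∘ₗ vec F V G

/-- The algebra homomorphism `F[G] → H_{λ,κ}`. -/
def hgrp (P : Params F V G) : MonoidAlgebra F G →ₐ[F] H P :=
  AlgHom.ofLinearMap ((toH P).toLinearMap ∘ₗ grp F V G)
    (by
      change toH P (grp F V G 1) = 1
      rw [← map_one (toH P)]
      exact RingQuot.mkAlgHom_rel F Rel.one)
    (fun x y => by
      change toH P (grp F V G (x * y)) = toH P (grp F V G x) * toH P (grp F V G y)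
      rw [← map_mul]
      exact RingQuot.mkAlgHom_rel F (Rel.mul x y))

/-- The map `F[G] ⊕ (V ⊗ F[G]) → H_{λ,κ}`, `(x, v ⊗ y) ↦ x + v y`. -/
def hlow (P : Params F V G) : (MonoidAlgebra F G × (V ⊗[F] MonoidAlgebra F G)) →ₗ[F] H P :=
  (toH P).toLinearMap ∘ₗ lowDegree F V G

variable (P : Params F V G)

theorem toH_vec (v : V) : toH P (vec F V G v) = hvec P v := rfl

theorem toH_grp (x : MonoidAlgebra F G) : toH P (grp F V G x) = hgrp P x := rfl

theorem hlow_inl (x : MonoidAlgebra F G) : hlow P (x, 0) = hgrp P x := by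
  simp [hlow, lowDegree, toH_grp]

theorem hlow_tmul (x : MonoidAlgebra F G) (v : V) (y : MonoidAlgebra F G) :
    hlow P (x, v ⊗ₜ y) = hgrp P x + hvec P v * hgrp P y := by
  simp [hlow, lowDegree, toH_grp, toH_vec]

theorem hgrp_mul_hvec (h : G) (v : V) :
    hgrp P (MonoidAlgebra.of F G h) * hvec P v =
      hvec P (h • v) * hgrp P (MonoidAlgebra.of F G h) +
        hgrp P (P.lam (MonoidAlgebra.of F G h) v) := by
  have h1 : toH P _ = toH P _ := RingQuot.mkAlgHom_rel F (Rel.cross (P := P) h v)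
  rwa [map_mul, map_add, map_mul] at h1

theorem hvec_mul_hvec (v w : V) :
    hvec P v * hvec P w = hvec P w * hvec P v + hlow P (P.kap v w) := by
  have h1 : toH P _ = toH P _ := RingQuot.mkAlgHom_rel F (Rel.comm (P := P) v w)
  rwa [map_mul, map_add, map_mul] at h1

/-! ### The filtration and its associated graded algebra -/

theorem filtration_mono {m n : ℕ} (h : m ≤ n) : filtration P m ≤ filtration P n :=
  Submodule.span_mono fun _ ⟨l, hl, hx⟩ => ⟨l, hl.trans h, hx⟩

theorem hvec_mem (v : V) : hvec P v ∈ filtration P 1 :=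
  Submodule.subset_span ⟨[Sum.inl v], by simp, by simp [letter, toH_vec]⟩

theorem hgrp_mem (x : MonoidAlgebra F G) : hgrp P x ∈ filtration P 0 :=
  Submodule.subset_span ⟨[Sum.inr x], by simp, by simp [letter, toH_grp]⟩

theorem hvec_mul_hgrp_mem (v : V) (x : MonoidAlgebra F G) :
    hvec P v * hgrp P x ∈ filtration P 1 := by
  have h := SetLike.mul_mem_graded (A := filtration P) (hvec_mem P v) (hgrp_mem P x)
  rwa [add_zero] at h

theorem hlow_mem (z : MonoidAlgebra F G × (V ⊗[F] MonoidAlgebra F G)) :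
    hlow P z ∈ filtration P 1 := by
  obtain ⟨x, t⟩ := z
  have h : hlow P (x, t) = hgrp P x + hlow P (0, t) := by
    rw [← hlow_inl, ← map_add]
    simp
  rw [h]
  refine Submodule.add_mem _ (filtration_mono P zero_le_one (hgrp_mem P x)) ?_
  induction t with
  | zero =>
    rw [Prod.mk_zero_zero, map_zero]
    exact Submodule.zero_mem _
  | tmul v y => simpa [hlow_tmul] using hvec_mul_hgrp_mem P v y
  | add a b ha hb =>
    have h2 : hlow P (0, a + b) = hlow P (0, a) + hlow P (0, b) := by
      rw [← map_add]
      simp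
    rw [h2]
    exact Submodule.add_mem _ (ha (by rw [← hlow_inl, ← map_add]; simp))
      (hb (by rw [← hlow_inl, ← map_add]; simp))

/-- The associated graded algebra of `H_{λ,κ}`. -/
abbrev Gr : Type _ := ⨁ n, GrPiece (filtration P) n

/-- The symbol of degree `n` of an element of the `n`-th step of the filtration. -/
def symb (n : ℕ) : filtration P n →ₗ[F] Gr P :=
  DirectSum.lof F ℕ (GrPiece (filtration P)) n ∘ₗ grMk (filtration P) n

theorem symb_eq_zero {n : ℕ} (x : filtration P n) :
    symb P n x = 0 ↔ (x : H P) ∈ prevStep (filtration P) n := by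
  rw [← grMk_eq_zero]
  exact map_eq_zero_iff (DirectSum.lof F ℕ (GrPiece (filtration P)) n)
    (DirectSum.of_injective (β := GrPiece (filtration P)) n)

theorem symb_congr {i j : ℕ} (h : i = j) (x : filtration P i) (y : filtration P j)
    (hxy : (x : H P) = y) : symb P i x = symb P j y :=
  DirectSum.of_eq_of_gradedMonoid_eq (gradedMk_eq (filtration P) h x y hxy)

theorem symb_mul {i j : ℕ} (x : filtration P i) (y : filtration P j) :
    symb P i x * symb P j y =
      symb P (i + j) ⟨(x : H P) * (y : H P), SetLike.mul_mem_graded x.2 y.2⟩ :=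
  DirectSum.of_mul_of _ _

theorem symb_one : symb P 0 ⟨1, SetLike.one_mem_graded _⟩ = 1 := rfl

/-- The symbol of a vector. -/
def grVec : V →ₗ[F] Gr P := symb P 1 ∘ₗ (hvec P).codRestrict _ (hvec_mem P)

/-- The symbol of an element of the group. -/
def grGrp : G →* Gr P where
  toFun h := symb P 0 ⟨hgrp P (MonoidAlgebra.of F G h), hgrp_mem P _⟩
  map_one' := by
    rw [← symb_one]
    exact symb_congr P rfl _ _ (by
      change hgrp P (MonoidAlgebra.of F G 1) = 1
      rw [map_one, map_one])
  map_mul' h k := by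
    rw [symb_mul]
    exact symb_congr P rfl _ _ (by
      change hgrp P (MonoidAlgebra.of F G (h * k)) =
        hgrp P (MonoidAlgebra.of F G h) * hgrp P (MonoidAlgebra.of F G k)
      rw [map_mul, map_mul])

theorem grVec_mul_grVec (v w : V) : grVec P v * grVec P w = grVec P w * grVec P v := by
  change symb P 1 _ * symb P 1 _ = symb P 1 _ * symb P 1 _
  rw [symb_mul, symb_mul, ← sub_eq_zero, ← map_sub, symb_eq_zero]
  change hvec P v * hvec P w - hvec P w * hvec P v ∈ filtration P 1
  rw [hvec_mul_hvec, add_sub_cancel_left]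
  exact hlow_mem P _

theorem grGrp_mul_grVec (h : G) (v : V) :
    grGrp P h * grVec P v = grVec P (h • v) * grGrp P h := by
  change symb P 0 _ * symb P 1 _ = symb P 1 _ * symb P 0 _
  rw [symb_mul, symb_mul, ← sub_eq_zero]
  have : symb P (0 + 1) ⟨hgrp P (MonoidAlgebra.of F G h) * hvec P v,
      SetLike.mul_mem_graded (hgrp_mem P _) (hvec_mem P _)⟩ =
      symb P (1 + 0) ⟨hgrp P (MonoidAlgebra.of F G h) * hvec P v,
      filtration_mono P (le_of_eq (add_comm 0 1))
        (SetLike.mul_mem_graded (hgrp_mem P _) (hvec_mem P _))⟩ :=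
    symb_congr P (add_comm 0 1) _ _ rfl
  refine (congrArg (· - _) this).trans ?_
  rw [← map_sub, symb_eq_zero]
  change hgrp P (MonoidAlgebra.of F G h) * hvec P v -
    hvec P (h • v) * hgrp P (MonoidAlgebra.of F G h) ∈ filtration P 0
  rw [hgrp_mul_hvec, add_sub_cancel_left]
  exact hgrp_mem P _

/-! ### The canonical map from `S(V) ⋊ G` -/

/-- A linear map with commuting values extends to the symmetric algebra, the target being possibly
noncommutative. -/
def symLift {B : Type*} [Semiring B] [Algebra F B] (f : V →ₗ[F] B)
    (hf : ∀ v w, f v * f w = f w * f v) : SymmetricAlgebra F V →ₐ[F] B :=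
  RingCon.liftₐ (TensorAlgebra.symRingCon F V) (TensorAlgebra.lift F f) (by
    refine RingCon.ringConGen_le.2 fun x y h => ?_
    induction h with
    | mul_comm x y => simpa [RingCon.ker_apply] using hf x y)

theorem symLift_ι {B : Type*} [Semiring B] [Algebra F B] (f : V →ₗ[F] B)
    (hf : ∀ v w, f v * f w = f w * f v) (v : V) :
    symLift f hf (SymmetricAlgebra.ι F V v) = f v :=
  TensorAlgebra.lift_ι_apply f v

theorem smul_ι (h : G) (v : V) :
    h • SymmetricAlgebra.ι F V v = SymmetricAlgebra.ι F V (h • v) := by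
  change symAct F h _ = _
  simp [symAct]

/-- The canonical graded homomorphism `S(V) ⋊ G → gr H_{λ,κ}`. -/
def toGr : SkewGroupAlgebra F V G →ₐ[F] Gr P :=
  SkewMonoidAlgebra.liftNCAlgHom (symLift (grVec P) (grVec_mul_grVec P)) (grGrp P) (by
    intro x h
    induction x using SymmetricAlgebra.induction with
    | algebraMap r =>
      rw [smul_algebraMap, AlgHom.commutes]
      exact Algebra.commutes _ _
    | ι v => rw [smul_ι, symLift_ι, symLift_ι, grGrp_mul_grVec]
    | mul a b ha hb =>
      rw [smul_mul', map_mul, map_mul, mul_assoc, hb, ← mul_assoc, ha, mul_assoc]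
    | add a b ha hb => rw [smul_add, map_add, map_add, add_mul, mul_add, ha, hb])

theorem toGr_mul (x y : SkewGroupAlgebra F V G) : toGr P (x * y) = toGr P x * toGr P y :=
  map_mul (toGr P) x y

theorem toGr_single (h : G) (s : SymmetricAlgebra F V) :
    toGr P (SkewMonoidAlgebra.single h s) =
      symLift (grVec P) (grVec_mul_grVec P) s * grGrp P h :=
  SkewMonoidAlgebra.liftNC_single _ _ _ _

end PBW

section Criterion

variable {F V G : Type*} [Field F] [AddCommGroup V] [Module F V] [Group G]
  [DistribMulAction G V] [SMulCommClass G F V]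

/-! ### The grading of `S(V) ⋊ G` -/

variable (F V) in
/-- The span of `V` in `S(V)`, whose `n`-th power is `Sⁿ(V)`. -/
abbrev symOne : Submodule F (SymmetricAlgebra F V) := LinearMap.range (SymmetricAlgebra.ι F V)

theorem single_mem_skewDegree {n : ℕ} (h : G) {s : SymmetricAlgebra F V}
    (hs : s ∈ symOne F V ^ n) : SkewMonoidAlgebra.single h s ∈ skewDegree F V G n := by
  classical
  intro k
  rw [SkewMonoidAlgebra.coeff_single_apply]
  split_ifs
  · exact hs
  · exact Submodule.zero_mem _

theorem skewDegree_le {n : ℕ} {N : Submodule F (SkewGroupAlgebra F V G)}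
    (hN : ∀ h : G, ∀ s ∈ symOne F V ^ n, SkewMonoidAlgebra.single h s ∈ N) :
    skewDegree F V G n ≤ N := by
  intro x hx
  rw [← SkewMonoidAlgebra.sum_single x, SkewMonoidAlgebra.sum_def, Finsupp.sum]
  exact Submodule.sum_mem _ fun h _ => hN h _ (hx h)

theorem smul_mem_symOne_pow {n : ℕ} (h : G) {s : SymmetricAlgebra F V}
    (hs : s ∈ symOne F V ^ n) : h • s ∈ symOne F V ^ n := by
  have h1 : (symOne F V).map (symAct F h).toLinearMap ≤ symOne F V := by
    rintro _ ⟨_, ⟨v, rfl⟩, rfl⟩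
    exact ⟨h • v, (smul_ι h v).symm⟩
  have h2 : (symOne F V ^ n).map (symAct F h).toLinearMap ≤ symOne F V ^ n := by
    rw [Submodule.map_pow]
    exact pow_le_pow_left' h1 n
  exact h2 ⟨s, hs, rfl⟩

theorem mul_mem_skewDegree {m n : ℕ} {x y : SkewGroupAlgebra F V G}
    (hx : x ∈ skewDegree F V G m) (hy : y ∈ skewDegree F V G n) :
    x * y ∈ skewDegree F V G (m + n) := by
  rw [← SkewMonoidAlgebra.sum_single x, ← SkewMonoidAlgebra.sum_single y,
    SkewMonoidAlgebra.sum_def, SkewMonoidAlgebra.sum_def, Finsupp.sum, Finsupp.sum,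
    Finset.sum_mul_sum]
  refine Submodule.sum_mem _ fun h _ => Submodule.sum_mem _ fun k _ => ?_
  rw [SkewMonoidAlgebra.single_mul_single]
  refine single_mem_skewDegree _ ?_
  rw [pow_add]
  exact Submodule.mul_mem_mul (hx h) (smul_mem_symOne_pow h (hy k))

theorem iSup_symOne_pow : ⨆ n, symOne F V ^ n = ⊤ := by
  refine top_unique fun s _ => ?_
  induction s using SymmetricAlgebra.induction with
  | algebraMap r =>
    refine Submodule.mem_iSup_of_mem 0 ?_
    rw [pow_zero]
    exact Submodule.algebraMap_mem r
  | ι v =>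
    refine Submodule.mem_iSup_of_mem 1 ?_
    rw [pow_one]
    exact ⟨v, rfl⟩
  | mul a b ha hb =>
    have h := Submodule.mul_mem_mul (ha trivial) (hb trivial)
    rw [Submodule.iSup_mul] at h
    simp_rw [Submodule.mul_iSup, ← pow_add] at h
    have h1 : ⨆ m, ⨆ n, symOne F V ^ (m + n) ≤ ⨆ n, symOne F V ^ n :=
      iSup_le fun m => iSup_le fun n => le_iSup (fun n => symOne F V ^ n) (m + n)
    exact h1 h
  | add a b ha hb => exact Submodule.add_mem _ (ha trivial) (hb trivial)

theorem iSup_skewDegree : ⨆ n, skewDegree F V G n = ⊤ := by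
  refine top_unique fun x _ => ?_
  rw [← SkewMonoidAlgebra.sum_single x, SkewMonoidAlgebra.sum_def, Finsupp.sum]
  refine Submodule.sum_mem _ fun h _ => ?_
  have h1 : (⨆ n, symOne F V ^ n) ≤
      (⨆ n, skewDegree F V G n).comap (SkewMonoidAlgebra.lsingle (R := F) h) :=
    iSup_le fun n s hs => Submodule.mem_iSup_of_mem n (single_mem_skewDegree h hs)
  exact h1 (by rw [iSup_symOne_pow]; trivial)

theorem finiteDimensional_skewDegree [FiniteDimensional F V] [Finite G] (n : ℕ) :
    FiniteDimensional F (skewDegree F V G n) := by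
  have h1 : (symOne F V ^ n).FG := (Submodule.FG.pow (Submodule.fg_range _) n)
  have h2 : (⨆ h : G, (symOne F V ^ n).map
      (SkewMonoidAlgebra.lsingle (R := F) h :
        SymmetricAlgebra F V →ₗ[F] SkewGroupAlgebra F V G)).FG :=
    Submodule.fg_iSup _ fun h => h1.map _
  have h3 := Module.Finite.iff_fg.2 h2
  have h4 : skewDegree F V G n ≤ ⨆ h : G, (symOne F V ^ n).map
      (SkewMonoidAlgebra.lsingle (R := F) h :
        SymmetricAlgebra F V →ₗ[F] SkewGroupAlgebra F V G) :=
    skewDegree_le fun h s hs => Submodule.mem_iSup_of_mem h ⟨s, hs, rfl⟩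
  exact Submodule.finiteDimensional_of_le h4

/-! ### The canonical map is graded and surjective -/

variable (P : Params F V G)

theorem symb_mem_range_mul {i j : ℕ} {x y : Gr P} (hx : x ∈ LinearMap.range (symb P i))
    (hy : y ∈ LinearMap.range (symb P j)) : x * y ∈ LinearMap.range (symb P (i + j)) := by
  obtain ⟨a, rfl⟩ := hx
  obtain ⟨b, rfl⟩ := hy
  exact ⟨_, (symb_mul P a b).symm⟩

theorem symLift_mem {n : ℕ} : ∀ {s : SymmetricAlgebra F V}, s ∈ symOne F V ^ n →
    symLift (grVec P) (grVec_mul_grVec P) s ∈ LinearMap.range (symb P n) := by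
  suffices h : symOne F V ^ n ≤ (LinearMap.range (symb P n)).comap
      (symLift (B := Gr P) (grVec P) (grVec_mul_grVec P)).toLinearMap from
    fun {_} hs => h hs
  induction n with
  | zero =>
    rw [pow_zero, Submodule.one_le, Submodule.mem_comap, AlgHom.toLinearMap_apply, map_one]
    exact ⟨_, symb_one P⟩
  | succ n ih =>
    rw [pow_succ, Submodule.mul_le]
    rintro a ha _ ⟨v, rfl⟩
    rw [Submodule.mem_comap, AlgHom.toLinearMap_apply, map_mul, symLift_ι]
    exact symb_mem_range_mul P (ih ha) ⟨_, rfl⟩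

theorem toGr_mem {n : ℕ} {x : SkewGroupAlgebra F V G} (hx : x ∈ skewDegree F V G n) :
    toGr P x ∈ LinearMap.range (symb P n) := by
  suffices h : skewDegree F V G n ≤ (LinearMap.range (symb P n)).comap (toGr P).toLinearMap from
    h hx
  refine skewDegree_le fun h s hs => ?_
  rw [Submodule.mem_comap, AlgHom.toLinearMap_apply, toGr_single]
  exact symb_mem_range_mul P (j := 0) (symLift_mem P hs) ⟨_, rfl⟩

theorem exists_toGr_eq_symb_hgrp (x : MonoidAlgebra F G) :
    ∃ z ∈ skewDegree F V G 0, toGr P z = symb P 0 ⟨hgrp P x, hgrp_mem P x⟩ := by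
  induction x using MonoidAlgebra.induction_linear with
  | zero => exact ⟨0, Submodule.zero_mem _, by
      rw [map_zero, eq_comm, symb_eq_zero]
      simp [prevStep]⟩
  | single h r =>
    refine ⟨r • SkewMonoidAlgebra.single h 1,
      Submodule.smul_mem _ _ (single_mem_skewDegree h (by
        rw [pow_zero]
        exact Submodule.one_le.1 le_rfl)), ?_⟩
    rw [map_smul, toGr_single, map_one, one_mul]
    change r • symb P 0 _ = _
    rw [← map_smul]
    refine symb_congr P rfl _ _ ?_
    change r • hgrp P (MonoidAlgebra.of F G h) = hgrp P (MonoidAlgebra.single h r)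
    rw [← map_smul, MonoidAlgebra.of_apply, MonoidAlgebra.smul_single, smul_eq_mul, mul_one]
  | add a b ha hb =>
    obtain ⟨y, hy, hy'⟩ := ha
    obtain ⟨z, hz, hz'⟩ := hb
    refine ⟨y + z, Submodule.add_mem _ hy hz, ?_⟩
    rw [map_add, hy', hz', ← map_add]
    exact symb_congr P rfl _ _ (map_add (hgrp P) a b).symm

theorem prod_letter_mem (l : List (V ⊕ MonoidAlgebra F G)) :
    (l.map (letter P)).prod ∈ filtration P (l.countP Sum.isLeft) :=
  Submodule.subset_span ⟨l, le_rfl, rfl⟩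

theorem exists_toGr_eq_symb_prod (l : List (V ⊕ MonoidAlgebra F G)) :
    ∃ z ∈ skewDegree F V G (l.countP Sum.isLeft),
      toGr P z = symb P _ ⟨(l.map (letter P)).prod, prod_letter_mem P l⟩ := by
  induction l with
  | nil =>
    exact ⟨1, single_mem_skewDegree 1 (by
      rw [List.countP_nil, pow_zero]
      exact Submodule.one_le.1 le_rfl), by rw [map_one]; rfl⟩
  | cons a l ih =>
    obtain ⟨z, hz, hz'⟩ := ih
    cases a with
    | inl v =>
      refine ⟨SkewMonoidAlgebra.single 1 (SymmetricAlgebra.ι F V v) * z, ?_, ?_⟩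
      · have h := mul_mem_skewDegree (single_mem_skewDegree (n := 1) (1 : G)
          (by rw [pow_one]; exact ⟨v, rfl⟩ : SymmetricAlgebra.ι F V v ∈ symOne F V ^ 1)) hz
        rwa [add_comm, ← List.countP_cons_of_pos (p := Sum.isLeft) (a := Sum.inl v) rfl] at h
      · rw [map_mul, hz', toGr_single, symLift_ι, map_one, mul_one]
        refine (symb_mul P ⟨hvec P v, hvec_mem P v⟩ _).trans ?_
        refine symb_congr P ?_ _ _ ?_
        · rw [add_comm, List.countP_cons_of_pos (p := Sum.isLeft) (a := Sum.inl v) rfl]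
        · simp [letter, toH_vec]
    | inr x =>
      obtain ⟨y, hy, hy'⟩ := exists_toGr_eq_symb_hgrp P x
      refine ⟨y * z, ?_, ?_⟩
      · have h := mul_mem_skewDegree hy hz
        rwa [zero_add, ← List.countP_cons_of_neg (p := Sum.isLeft) (a := Sum.inr x) (by simp)] at h
      · rw [map_mul, hz', hy']
        refine (symb_mul P _ _).trans ?_
        refine symb_congr P ?_ _ _ ?_
        · rw [zero_add, List.countP_cons_of_neg (p := Sum.isLeft) (a := Sum.inr x) (by simp)]
        · simp [letter, toH_grp]

theorem exists_toGr_eq_symb {n : ℕ} (x : filtration P n) :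
    ∃ z ∈ skewDegree F V G n, toGr P z = symb P n x := by
  obtain ⟨x, hx⟩ := x
  induction hx using Submodule.span_induction with
  | mem x h =>
    obtain ⟨l, hl, rfl⟩ := h
    rcases hl.eq_or_lt with rfl | hl
    · exact exists_toGr_eq_symb_prod P l
    · refine ⟨0, Submodule.zero_mem _, ?_⟩
      rw [map_zero, eq_comm, symb_eq_zero]
      obtain ⟨m, rfl⟩ := Nat.exists_eq_succ_of_ne_zero (Nat.ne_zero_of_lt hl)
      exact filtration_mono P (Nat.lt_succ_iff.1 hl) (prod_letter_mem P l)
  | zero =>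
    refine ⟨0, Submodule.zero_mem _, ?_⟩
    rw [map_zero]
    exact (map_zero (symb P n)).symm
  | add a b ha hb iha ihb =>
    obtain ⟨y, hy, hy'⟩ := iha
    obtain ⟨z, hz, hz'⟩ := ihb
    refine ⟨y + z, Submodule.add_mem _ hy hz, ?_⟩
    rw [map_add, hy', hz', ← map_add]
    rfl
  | smul c a ha iha =>
    obtain ⟨y, hy, hy'⟩ := iha
    refine ⟨c • y, Submodule.smul_mem _ _ hy, ?_⟩
    rw [map_smul, hy', ← map_smul]
    rfl

theorem map_toGr_skewDegree (n : ℕ) :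
    (skewDegree F V G n).map (toGr P).toLinearMap = LinearMap.range (symb P n) := by
  refine le_antisymm ?_ ?_
  · rintro _ ⟨x, hx, rfl⟩
    exact toGr_mem P hx
  · rintro _ ⟨x, rfl⟩
    obtain ⟨z, hz, hz'⟩ := exists_toGr_eq_symb P x
    exact ⟨z, hz, hz'⟩

theorem range_lof (n : ℕ) :
    LinearMap.range (DirectSum.lof F ℕ (GrPiece (filtration P)) n) =
      LinearMap.range (symb P n) := by
  rw [symb, LinearMap.range_comp, LinearMap.range_eq_top.2 (grMk_surjective (filtration P) n),
    Submodule.map_top]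

theorem toGr_surjective : Function.Surjective (toGr P) := by
  intro y
  induction y using DirectSum.induction_on with
  | zero => exact ⟨0, map_zero _⟩
  | of n a =>
    obtain ⟨x, rfl⟩ := grMk_surjective (filtration P) n a
    obtain ⟨z, -, hz⟩ := exists_toGr_eq_symb P x
    exact ⟨z, hz⟩
  | add a b ha hb =>
    obtain ⟨y, rfl⟩ := ha
    obtain ⟨z, rfl⟩ := hb
    exact ⟨y + z, map_add _ _ _⟩

theorem toGr_injective (hP : ∀ n, ∀ z ∈ skewDegree F V G n, toGr P z = 0 → z = 0) :
    Function.Injective (toGr P) := by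
  rw [injective_iff_map_eq_zero]
  intro x hx
  have hx1 : x ∈ ⨆ n, skewDegree F V G n := by rw [iSup_skewDegree]; trivial
  obtain ⟨f, hf, rfl⟩ := (Submodule.mem_iSup_iff_exists_finsupp _ _).1 hx1
  choose a ha using fun n => toGr_mem P (hf n)
  refine Finset.sum_eq_zero fun n _ => hP n _ (hf n) ?_
  rw [Finsupp.sum, map_sum] at hx
  simp_rw [← ha] at hx
  rw [← ha]
  have h1 := congrArg (DirectSum.component F ℕ (GrPiece (filtration P)) n) hx
  rw [map_sum, map_zero] at h1
  by_cases hn : n ∈ f.support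
  · rw [Finset.sum_eq_single n] at h1
    · have h2 : grMk (filtration P) n (a n) = 0 := by
        rw [← h1]
        exact (DirectSum.component.lof_self F _ _).symm
      rw [symb, LinearMap.comp_apply, h2, map_zero]
    · intro m _ hm
      exact (DirectSum.component.of F (M := GrPiece (filtration P)) n m _).trans (dif_neg hm)
    · exact fun h => absurd hn h
  · rw [ha, Finsupp.notMem_support_iff.1 hn, map_zero]

/-- `H_{λ,κ}` is a Drinfeld orbifold algebra if and only if the canonical graded surjection
`S(V) ⋊ G → gr H_{λ,κ}` is injective in each degree. An abstract graded isomorphism suffices, since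
the graded pieces have finite dimension. -/
theorem isDrinfeldOrbifoldAlgebra_iff [FiniteDimensional F V] [Finite G] :
    IsDrinfeldOrbifoldAlgebra P ↔ ∀ n, ∀ z ∈ skewDegree F V G n, toGr P z = 0 → z = 0 := by
  constructor
  · rintro ⟨e, he⟩ n z hz h0
    have := finiteDimensional_skewDegree (F := F) (V := V) (G := G) n
    have e1 := e.toLinearEquiv.submoduleMap (LinearMap.range (symb P n))
    have h1 : (LinearMap.range (symb P n)).map (e.toLinearEquiv : Gr P →ₗ[F] _) =
      skewDegree F V G n := by
      rw [← range_lof]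
      exact he n
    rw [h1] at e1
    let f : skewDegree F V G n →ₗ[F] LinearMap.range (symb P n) :=
      (toGr P).toLinearMap.restrict fun x hx => toGr_mem P hx
    have hf : Function.Surjective f := by
      rintro ⟨_, x, rfl⟩
      obtain ⟨y, hy, hy'⟩ := exists_toGr_eq_symb P x
      exact ⟨⟨y, hy⟩, Subtype.ext hy'⟩
    have hf' := (LinearMap.injective_iff_surjective (K := F)
      (V := skewDegree F V G n) (f := e1.toLinearMap ∘ₗ f)).2
      (show Function.Surjective (e1.toLinearMap ∘ₗ f) from e1.surjective.comp hf)
    have h2 : (⟨z, hz⟩ : skewDegree F V G n) = 0 := hf' (by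
      rw [map_zero, LinearMap.comp_apply]
      exact (congrArg e1 (Subtype.ext h0 : f ⟨z, hz⟩ = 0)).trans (map_zero e1))
    exact congrArg Subtype.val h2
  · intro h
    refine ⟨(AlgEquiv.ofBijective (toGr P) ⟨toGr_injective P h, toGr_surjective P⟩).symm,
      fun n => ?_⟩
    rw [range_lof, ← map_toGr_skewDegree, ← Submodule.map_comp]
    convert Submodule.map_id _
    refine LinearMap.ext fun x => ?_
    exact AlgEquiv.symm_apply_apply
      (AlgEquiv.ofBijective (toGr P) ⟨toGr_injective P h, toGr_surjective P⟩) x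

end Criterion

section LowDegree

variable {F V G : Type*} [Field F] [AddCommGroup V] [Module F V] [Group G]
  [DistribMulAction G V] [SMulCommClass G F V]

/-! ### Elements of degree at most one -/

theorem ι_injective : Function.Injective (SymmetricAlgebra.ι F V) := by
  rw [injective_iff_map_eq_zero]
  intro v hv
  rw [← Module.forall_dual_apply_eq_zero_iff F v]
  intro f
  rw [← SymmetricAlgebra.lift_ι_apply f v, hv, map_zero]

/-- The embedding `V ⊗ F[G] → S(V) ⋊ G`, `v ⊗ h ↦ v h`. -/
def skewOne : V ⊗[F] MonoidAlgebra F G →ₗ[F] SkewGroupAlgebra F V G :=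
  TensorProduct.lift
    (LinearMap.flip
      ((Finsupp.lsum F fun h => LinearMap.toSpanSingleton F _
        ((SkewMonoidAlgebra.lsingle (R := F) h :
          SymmetricAlgebra F V →ₗ[F] SkewGroupAlgebra F V G) ∘ₗ SymmetricAlgebra.ι F V)) ∘ₗ
        (MonoidAlgebra.coeffLinearEquiv F).toLinearMap))

theorem skewOne_tmul_single (v : V) (h : G) (r : F) :
    skewOne (v ⊗ₜ[F] MonoidAlgebra.single h r) =
      r • SkewMonoidAlgebra.single h (SymmetricAlgebra.ι F V v) := by
  simp [skewOne]
  rfl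

theorem tensor_induction {C : V ⊗[F] MonoidAlgebra F G → Prop} (t : V ⊗[F] MonoidAlgebra F G)
    (h0 : C 0) (h1 : ∀ v h, C (v ⊗ₜ MonoidAlgebra.single h 1))
    (h2 : ∀ a b, C a → C b → C (a + b)) : C t := by
  induction t with
  | zero => exact h0
  | add a b ha hb => exact h2 a b ha hb
  | tmul v y =>
    induction y using MonoidAlgebra.induction_linear with
    | zero => rwa [TensorProduct.tmul_zero]
    | add a b ha hb => rw [TensorProduct.tmul_add]; exact h2 _ _ ha hb
    | single h r =>
      have : v ⊗ₜ[F] MonoidAlgebra.single h r = (r • v) ⊗ₜ MonoidAlgebra.single h 1 := by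
        rw [TensorProduct.smul_tmul, MonoidAlgebra.smul_single, smul_eq_mul, mul_one]
      rw [this]
      exact h1 _ _

theorem skewOne_injective : Function.Injective (skewOne (F := F) (V := V) (G := G)) := by
  obtain ⟨π, hπ⟩ := LinearMap.exists_leftInverse_of_injective (SymmetricAlgebra.ι F V)
    (LinearMap.ker_eq_bot.2 ι_injective)
  let L : SkewGroupAlgebra F V G →+ V ⊗[F] MonoidAlgebra F G :=
    (Finsupp.liftAddHom fun h =>
      ((TensorProduct.mk F V (MonoidAlgebra F G)).flip (MonoidAlgebra.single h 1) ∘ₗ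
        π).toAddMonoidHom).comp SkewMonoidAlgebra.coeffAddEquiv.toAddMonoidHom
  have hL : Function.LeftInverse L (skewOne (F := F) (V := V) (G := G)) := by
    intro t
    induction t using tensor_induction with
    | h0 => rw [map_zero, map_zero]
    | h2 a b ha hb => rw [map_add, map_add, ha, hb]
    | h1 v h =>
      have := LinearMap.congr_fun hπ v
      rw [LinearMap.comp_apply] at this
      simp [skewOne_tmul_single, L, SkewMonoidAlgebra.coeffAddEquiv, this]
  exact hL.injective

/-- The embedding `F[G] → S(V) ⋊ G`. -/
def skewZero : MonoidAlgebra F G →ₗ[F] SkewGroupAlgebra F V G :=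
  (Finsupp.lsum F fun h => LinearMap.toSpanSingleton F _ (SkewMonoidAlgebra.single h 1)) ∘ₗ
    (MonoidAlgebra.coeffLinearEquiv F).toLinearMap

theorem skewZero_single (h : G) (r : F) :
    skewZero (V := V) (MonoidAlgebra.single h r) =
      r • SkewMonoidAlgebra.single h (1 : SymmetricAlgebra F V) := by
  simp [skewZero]

theorem skewZero_injective : Function.Injective (skewZero (F := F) (V := V) (G := G)) := by
  let L : SkewGroupAlgebra F V G →+ MonoidAlgebra F G :=
    (Finsupp.liftAddHom fun h => (MonoidAlgebra.singleAddHom h).comp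
      (SymmetricAlgebra.algebraMapInv (R := F) (M := V)).toLinearMap.toAddMonoidHom).comp
        SkewMonoidAlgebra.coeffAddEquiv.toAddMonoidHom
  have hL : Function.LeftInverse L (skewZero (F := F) (V := V) (G := G)) := by
    intro t
    induction t using MonoidAlgebra.induction_linear with
    | zero => rw [map_zero, map_zero]
    | add a b ha hb => rw [map_add, map_add, ha, hb]
    | single h r => simp [skewZero_single, L, SkewMonoidAlgebra.coeffAddEquiv]
  exact hL.injective

theorem one_mem_symOne_pow_zero : (1 : SymmetricAlgebra F V) ∈ symOne F V ^ 0 := by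
  rw [pow_zero]
  exact Submodule.one_le.1 le_rfl

theorem skewZero_mem (x : MonoidAlgebra F G) : skewZero x ∈ skewDegree F V G 0 := by
  induction x using MonoidAlgebra.induction_linear with
  | zero => rw [map_zero]; exact Submodule.zero_mem _
  | add a b ha hb => rw [map_add]; exact Submodule.add_mem _ ha hb
  | single h r =>
    rw [skewZero_single]
    exact Submodule.smul_mem _ _ (single_mem_skewDegree h one_mem_symOne_pow_zero)

theorem skewOne_mem (t : V ⊗[F] MonoidAlgebra F G) : skewOne t ∈ skewDegree F V G 1 := by
  induction t using tensor_induction with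
  | h0 => rw [map_zero]; exact Submodule.zero_mem _
  | h2 a b ha hb => rw [map_add]; exact Submodule.add_mem _ ha hb
  | h1 v h =>
    rw [skewOne_tmul_single, one_smul]
    exact single_mem_skewDegree h (by rw [pow_one]; exact ⟨v, rfl⟩)

variable (P : Params F V G)

theorem toGr_skewZero (x : MonoidAlgebra F G) :
    toGr P (skewZero x) = symb P 0 ⟨hgrp P x, hgrp_mem P x⟩ := by
  suffices h : (toGr P).toLinearMap ∘ₗ skewZero =
      symb P 0 ∘ₗ (hgrp P).toLinearMap.codRestrict _ (hgrp_mem P) from LinearMap.congr_fun h x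
  refine LinearMap.ext fun x => ?_
  induction x using MonoidAlgebra.induction_linear with
  | zero => rw [map_zero, map_zero]
  | add a b ha hb => rw [map_add, map_add, ha, hb]
  | single h r =>
    have h1 : MonoidAlgebra.single h r = r • MonoidAlgebra.of F G h := by
      rw [MonoidAlgebra.of_apply, MonoidAlgebra.smul_single, smul_eq_mul, mul_one]
    rw [h1, map_smul, map_smul, MonoidAlgebra.of_apply, LinearMap.comp_apply, skewZero_single,
      one_smul, AlgHom.toLinearMap_apply, toGr_single, map_one, one_mul]
    rfl

theorem toGr_skewOne (t : V ⊗[F] MonoidAlgebra F G) :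
    toGr P (skewOne t) = symb P 1 ⟨hlow P (0, t), hlow_mem P _⟩ := by
  suffices h : (toGr P).toLinearMap ∘ₗ skewOne =
      symb P 1 ∘ₗ (hlow P ∘ₗ LinearMap.inr F _ _).codRestrict _ (fun t => hlow_mem P (0, t)) from
    LinearMap.congr_fun h t
  refine LinearMap.ext fun t => ?_
  induction t using tensor_induction with
  | h0 => rw [map_zero, map_zero]
  | h2 a b ha hb => rw [map_add, map_add, ha, hb]
  | h1 v h =>
    rw [LinearMap.comp_apply, skewOne_tmul_single,
      one_smul, AlgHom.toLinearMap_apply, toGr_single, symLift_ι]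
    refine (symb_mul P ⟨hvec P v, hvec_mem P v⟩
      ⟨hgrp P (MonoidAlgebra.of F G h), hgrp_mem P _⟩).trans ?_
    refine symb_congr P rfl _ _ ?_
    change hvec P v * hgrp P (MonoidAlgebra.of F G h) = hlow P (0, v ⊗ₜ MonoidAlgebra.single h 1)
    rw [hlow_tmul, map_zero, zero_add, MonoidAlgebra.of_apply]

/-- In a Drinfeld orbifold algebra the space `F[G] ⊕ (V ⊗ F[G])` embeds. -/
theorem hlow_injective [FiniteDimensional F V] [Finite G] (hP : IsDrinfeldOrbifoldAlgebra P) :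
    Function.Injective (hlow P) := by
  rw [isDrinfeldOrbifoldAlgebra_iff] at hP
  rw [injective_iff_map_eq_zero]
  rintro ⟨x, t⟩ h
  have h1 : hlow P (x, t) = hgrp P x + hlow P (0, t) := by
    rw [← hlow_inl, ← map_add]
    simp
  have ht : t = 0 := by
    refine skewOne_injective ((hP 1 _ (skewOne_mem t) ?_).trans (map_zero _).symm)
    rw [toGr_skewOne, symb_eq_zero]
    change hlow P (0, t) ∈ filtration P 0
    rw [eq_neg_of_add_eq_zero_right (h1.symm.trans h)]
    exact Submodule.neg_mem _ (hgrp_mem P x)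
  subst ht
  have hx : x = 0 := by
    refine skewZero_injective ((hP 0 _ (skewZero_mem x) ?_).trans (map_zero _).symm)
    rw [toGr_skewZero, symb_eq_zero]
    change hgrp P x ∈ (⊥ : Submodule F (H P))
    rw [Submodule.mem_bot, ← hlow_inl, h]
  rw [hx, Prod.mk_zero_zero]

theorem hgrp_injective [FiniteDimensional F V] [Finite G] (hP : IsDrinfeldOrbifoldAlgebra P) :
    Function.Injective (hgrp P) := by
  intro x y h
  rw [← hlow_inl, ← hlow_inl] at h
  exact congrArg Prod.fst (hlow_injective P hP h)

/-- The parameter functions can be read off from the ideal of relations, since the degree at most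
one part of the free product embeds into the quotient. -/
theorem injOn_ker_toH [FiniteDimensional F V] [Finite G] :
    Set.InjOn (fun P : Params F V G => RingHom.ker (toH P)) {P | IsDrinfeldOrbifoldAlgebra P} := by
  intro P hP Q _ hPQ
  have key : ∀ x y, toH Q x = toH Q y → toH P x = toH P y := by
    intro x y h
    rw [← sub_eq_zero, ← map_sub, ← RingHom.mem_ker] at h ⊢
    exact (SetLike.ext_iff.1 hPQ _).2 h
  refine Params.ext ?_ ?_
  · refine LinearMap.ext fun x => ?_
    induction x using MonoidAlgebra.induction_linear with
    | zero => rw [map_zero, map_zero]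
    | add a b ha hb => rw [map_add, map_add, ha, hb]
    | single h r =>
      refine LinearMap.ext fun v => ?_
      have h1 : MonoidAlgebra.single h r = r • MonoidAlgebra.of F G h := by
        rw [MonoidAlgebra.of_apply, MonoidAlgebra.smul_single, smul_eq_mul, mul_one]
      rw [h1, map_smul, map_smul, LinearMap.smul_apply, LinearMap.smul_apply]
      congr 1
      refine hgrp_injective P hP ?_
      have h2 := key _ _ (RingQuot.mkAlgHom_rel F (Rel.cross (P := Q) h v))
      have h3 := hgrp_mul_hvec P h v
      rw [map_mul, map_add, map_mul] at h2
      exact add_left_cancel (h3.symm.trans h2)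
  · refine LinearMap.ext₂ fun v w => ?_
    refine hlow_injective P hP ?_
    have h2 := key _ _ (RingQuot.mkAlgHom_rel F (Rel.comm (P := Q) v w))
    have h3 := hvec_mul_hvec P v w
    rw [map_mul, map_add, map_mul] at h2
    exact add_left_cancel (h3.symm.trans h2)

end LowDegree

section Ore

variable {F A : Type*} [Field F] [CommRing A] [Algebra F A]

/-! ### The differential operator algebra `A[x; δ]` -/

/-- The relations of `A[x; δ]` on the free algebra generated by the vector space `F x ⊕ A`: those of
`A`, and `a x = x a + δ(a)`. -/
inductive OreRel (δ : Derivation F A A) :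
    TensorAlgebra F (F × A) → TensorAlgebra F (F × A) → Prop
  | one : OreRel δ (TensorAlgebra.ι F (0, 1)) 1
  | mul (a a' : A) : OreRel δ (TensorAlgebra.ι F (0, a * a'))
      (TensorAlgebra.ι F (0, a) * TensorAlgebra.ι F (0, a'))
  | cross (a : A) : OreRel δ (TensorAlgebra.ι F (0, a) * TensorAlgebra.ι F (1, 0))
      (TensorAlgebra.ι F (1, 0) * TensorAlgebra.ι F (0, a) + TensorAlgebra.ι F (0, δ a))

/-- The differential operator algebra `A[x; δ]`, in which `a x = x a + δ(a)` for `a ∈ A`. -/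
def Ore (δ : Derivation F A A) : Type _ := RingQuot (OreRel δ)

instance (δ : Derivation F A A) : Ring (Ore δ) := inferInstanceAs (Ring (RingQuot (OreRel δ)))

instance (δ : Derivation F A A) : Algebra F (Ore δ) :=
  inferInstanceAs (Algebra F (RingQuot (OreRel δ)))

variable (δ : Derivation F A A)

/-- The quotient map onto `A[x; δ]`. -/
def toOre : TensorAlgebra F (F × A) →ₐ[F] Ore δ := RingQuot.mkAlgHom F (OreRel δ)

theorem toOre_rel {u v : TensorAlgebra F (F × A)} (h : OreRel δ u v) : toOre δ u = toOre δ v :=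
  RingQuot.mkAlgHom_rel F h

theorem toOre_surjective : Function.Surjective (toOre δ) :=
  RingQuot.mkAlgHom_surjective F (OreRel δ)

/-- The variable `x` of `A[x; δ]`. -/
def oreX : Ore δ := toOre δ (TensorAlgebra.ι F (1, 0))

/-- The coefficients in `A[x; δ]`. -/
def oreC : A →ₐ[F] Ore δ :=
  AlgHom.ofLinearMap ((toOre δ).toLinearMap ∘ₗ TensorAlgebra.ι F ∘ₗ
    LinearMap.inr F F A)
    (by
      refine Eq.trans ?_ (map_one (toOre δ))
      exact toOre_rel δ OreRel.one)
    (fun x y => by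
      refine Eq.trans ?_ (map_mul (toOre δ) _ _)
      exact toOre_rel δ (OreRel.mul x y))

theorem oreC_mul_oreX (a : A) : oreC δ a * oreX δ = oreX δ * oreC δ a + oreC δ (δ a) := by
  have h := toOre_rel δ (OreRel.cross a)
  rw [map_mul, map_add, map_mul] at h
  exact h

variable {δ} in
/-- The universal property of `A[x; δ]`. -/
def oreLift {R : Type*} [Ring R] [Algebra F R] (f : A →ₐ[F] R) (x : R)
    (hx : ∀ a, f a * x = x * f a + f (δ a)) : Ore δ →ₐ[F] R :=
  RingQuot.liftAlgHom F ⟨TensorAlgebra.lift F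
    ((LinearMap.toSpanSingleton F R x).coprod f.toLinearMap), by
      intro u v h
      induction h with
      | one => simp
      | mul a a' => simp
      | cross a => simpa using hx a⟩

variable {δ} in
theorem oreLift_oreX {R : Type*} [Ring R] [Algebra F R] (f : A →ₐ[F] R) (x : R)
    (hx : ∀ a, f a * x = x * f a + f (δ a)) : oreLift f x hx (oreX δ) = x := by
  rw [oreX]
  refine (RingQuot.liftAlgHom_mkAlgHom_apply F _ _ _).trans ?_
  simp

variable {δ} in
theorem oreLift_oreC {R : Type*} [Ring R] [Algebra F R] (f : A →ₐ[F] R) (x : R)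
    (hx : ∀ a, f a * x = x * f a + f (δ a)) (a : A) : oreLift f x hx (oreC δ a) = f a := by
  refine (RingQuot.liftAlgHom_mkAlgHom_apply F _ _ _).trans ?_
  simp

variable {δ} in
theorem ore_induction {C : Ore δ → Prop} (hX : C (oreX δ)) (hC : ∀ a, C (oreC δ a))
    (hadd : ∀ x y, C x → C y → C (x + y)) (hmul : ∀ x y, C x → C y → C (x * y))
    (z : Ore δ) : C z := by
  have halg : ∀ r : F, C (algebraMap F _ r) := fun r => by
    rw [← (oreC δ).commutes r]
    exact hC _
  obtain ⟨w, rfl⟩ := toOre_surjective δ z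
  induction w using TensorAlgebra.induction with
  | algebraMap r => rw [AlgHom.commutes]; exact halg r
  | add u v hu hv => rw [map_add]; exact hadd _ _ hu hv
  | mul u v hu hv => rw [map_mul]; exact hmul _ _ hu hv
  | ι m =>
    obtain ⟨r, a⟩ := m
    have h : TensorAlgebra.ι F (r, a) =
        algebraMap F _ r * TensorAlgebra.ι F ((1, 0) : F × A) + TensorAlgebra.ι F (0, a) := by
      rw [← Algebra.smul_def, ← map_smul, ← map_add]
      simp
    rw [h, map_add, map_mul, AlgHom.commutes]
    exact hadd _ _ (hmul _ _ (halg r) hX) (hC a)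

/-! ### The representation of `A[x; δ]` on polynomials with coefficients in `A` -/

/-- Left multiplication by `x` on `∑ aₙ xⁿ`, where `x a = a x - δ(a)`. -/
def oreShift : Module.End F (ℕ → A) where
  toFun m n := (match n with
    | 0 => 0
    | k + 1 => m k) - δ (m n)
  map_add' m m' := by
    funext n
    cases n <;> simp <;> abel
  map_smul' r m := by
    funext n
    cases n <;> simp [smul_sub]

/-- The representation of `A[x; δ]` on series `∑ aₙ xⁿ`. -/
def oreRep : Ore δ →ₐ[F] Module.End F (ℕ → A) :=
  oreLift (Algebra.lsmul F F (ℕ → A)) (oreShift δ) (by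
    intro a
    refine LinearMap.ext fun m => funext fun n => ?_
    cases n
    · simp [oreShift]
      ring
    · simp [oreShift]
      ring)

theorem oreShift_single (i : ℕ) :
    oreShift δ (Pi.single i 1) = Pi.single (i + 1) 1 := by
  funext n
  cases n with
  | zero => by_cases h : i = 0 <;> simp [oreShift, h, eq_comm]
  | succ n =>
    have h : δ (if n + 1 = i then 1 else 0) = 0 := by
      split_ifs <;> simp
    simp [oreShift, Pi.single_apply, h]

theorem oreRep_monomial (a : A) (i : ℕ) :
    oreRep δ (oreC δ a * oreX δ ^ i) (Pi.single 0 1) = Pi.single i a := by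
  have h : (oreShift δ ^ i) (Pi.single 0 1) = Pi.single i 1 := by
    induction i with
    | zero => simp
    | succ i ih => rw [pow_succ', Module.End.mul_apply, ih, oreShift_single]
  rw [map_mul, map_pow, oreRep, oreLift_oreC, oreLift_oreX, Module.End.mul_apply, h]
  funext n
  by_cases hn : n = i <;> simp [hn]

end Ore

section SkewDerivation

variable {F A : Type*} [Field F] [CommRing A] [Algebra F A]

/-! ### A skew derivation of `A[x; δ]` -/

variable (E : Derivation F A A)

/-- The operator `E (E - 1) / 2`. -/
def chooseTwo : A →ₗ[F] A :=
  (2⁻¹ : F) • ((E : A →ₗ[F] A) ∘ₗ (E : A →ₗ[F] A) - (E : A →ₗ[F] A))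

theorem chooseTwo_apply (a : A) : chooseTwo E a = (2⁻¹ : F) • (E (E a) - E a) := rfl

theorem two_mul_chooseTwo (h2 : (2 : F) ≠ 0) (a : A) :
    2 * chooseTwo E a = E (E a) - E a := by
  have h : (2 : A) = algebraMap F A 2 := (map_ofNat (algebraMap F A) 2).symm
  rw [h, ← Algebra.smul_def, chooseTwo_apply, smul_smul, mul_inv_cancel₀ h2, one_smul]

theorem chooseTwo_mul (h2 : (2 : F) ≠ 0) (x y : A) :
    chooseTwo E (x * y) = x * chooseTwo E y + chooseTwo E x * y + E x * E y := by
  have hA : IsUnit (2 : A) := by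
    have h : (2 : A) = algebraMap F A 2 := (map_ofNat (algebraMap F A) 2).symm
    rw [h]
    exact (IsUnit.mk0 _ h2).map _
  refine hA.mul_left_cancel ?_
  have hx := two_mul_chooseTwo E h2 x
  have hy := two_mul_chooseTwo E h2 y
  rw [two_mul_chooseTwo E h2]
  simp only [Derivation.leibniz, smul_eq_mul, map_add]
  linear_combination (-x) * hy - y * hx

theorem derivation_chooseTwo (a : A) : E (chooseTwo E a) = chooseTwo E (E a) := by
  rw [chooseTwo_apply, chooseTwo_apply, Derivation.map_smul, map_sub]

variable (b c : A)

/-- The skew derivation on coefficients, `a ↦ -x E(a) - (b E(E-1)/2 + c E)(a)`. -/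
def skewDerC : A →ₗ[F] Ore (b • E) :=
  -(LinearMap.mulLeft F (oreX (b • E)) ∘ₗ (oreC (b • E)).toLinearMap ∘ₗ (E : A →ₗ[F] A)) -
    (oreC (b • E)).toLinearMap ∘ₗ (LinearMap.mulLeft F b ∘ₗ chooseTwo E +
      LinearMap.mulLeft F c ∘ₗ (E : A →ₗ[F] A))

theorem skewDerC_apply (a : A) : skewDerC E b c a =
    -(oreX (b • E) * oreC (b • E) (E a)) - oreC (b • E) (b * chooseTwo E a + c * E a) := rfl

theorem skewDerC_mul (h2 : (2 : F) ≠ 0) (x y : A) : skewDerC E b c (x * y) =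
    oreC (b • E) x * skewDerC E b c y + skewDerC E b c x * oreC (b • E) y := by
  have hx := oreC_mul_oreX (b • E) x
  have h1 : oreC (b • E) x * skewDerC E b c y + skewDerC E b c x * oreC (b • E) y =
      -(oreX (b • E) * oreC (b • E) (x * E y + E x * y)) -
        oreC (b • E) ((b • E) x * E y + x * (b * chooseTwo E y + c * E y) +
          (b * chooseTwo E x + c * E x) * y) := by
    simp only [skewDerC_apply, mul_sub, sub_mul, mul_neg, neg_mul, ← mul_assoc, hx, add_mul,
      map_add, map_mul, mul_add]
    abel
  rw [h1, skewDerC_apply, chooseTwo_mul E h2]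
  simp only [Derivation.leibniz, smul_eq_mul, Derivation.smul_apply]
  congr 2
  · congr 2
    ring
  · ring

/-- The matrices `(σ(a), D(a); 0, a)` for `a ∈ A`, where `σ(a) = a`. -/
def skewMatC (h2 : (2 : F) ≠ 0) : A →ₐ[F] Matrix (Fin 2) (Fin 2) (Ore (b • E)) :=
  AlgHom.ofLinearMap
    { toFun := fun a => !![oreC (b • E) a, skewDerC E b c a; 0, oreC (b • E) a]
      map_add' := fun x y => by
        ext i j
        fin_cases i <;> fin_cases j <;> simp
      map_smul' := fun r x => by
        ext i j
        fin_cases i <;> fin_cases j <;> simp }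
    (by
      have h : skewDerC E b c 1 = 0 := by
        simp [skewDerC_apply, chooseTwo_apply]
      ext i j
      fin_cases i <;> fin_cases j <;> simp [h])
    (fun x y => by
      ext i j
      fin_cases i <;> fin_cases j <;> 
        simp [Matrix.mul_apply, Fin.sum_univ_two, skewDerC_mul E b c h2])

variable (α κ : A)

/-- The value `-κ - x α - D(β)` of the skew derivation at `x`, where `β = E(b)`. -/
def skewDerX : Ore (b • E) :=
  -oreC (b • E) κ - oreX (b • E) * oreC (b • E) α - skewDerC E b c (E b)

/-- The skew derivation is compatible with the relation `a x = x a + δ(a)`. This is the only place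
where the condition on `b` is needed. -/
theorem skewMat_cross (h2 : (2 : F) ≠ 0)
    (hcond : b * (α + E c - chooseTwo E b - E b) = 0) (a : A) :
    oreC (b • E) a * skewDerX E b c α κ + skewDerC E b c a * oreX (b • E) =
      (oreX (b • E) - oreC (b • E) (E b)) * skewDerC E b c a +
        skewDerX E b c α κ * oreC (b • E) a + skewDerC E b c ((b • E) a) := by
  have h1 := oreC_mul_oreX (b • E) a
  have h3 := oreC_mul_oreX (b • E) (E a)
  have h4 := oreC_mul_oreX (b • E) (b * chooseTwo E a + c * E a)
  have h5 := oreC_mul_oreX (b • E) (E b)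
  have hDX : skewDerX E b c α κ = oreX (b • E) * oreC (b • E) (E (E b) - α) +
      oreC (b • E) (b * chooseTwo E (E b) + c * E (E b) - κ) := by
    rw [skewDerX, skewDerC_apply, map_sub, map_sub]
    noncomm_ring
  have hDa := skewDerC_apply E b c a
  have hDδ := skewDerC_apply E b c ((b • E) a)
  set φ := oreC (b • E)
  set X := oreX (b • E)
  set e := E a with he
  set w := b * chooseTwo E a + c * e with hw
  set w' := b * chooseTwo E ((b • E) a) + c * E ((b • E) a) with hw'
  set s := E (E b) - α with hs
  set r := b * chooseTwo E (E b) + c * E (E b) - κ with hr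
  have key : φ a * (X * φ s + φ r) + (-(X * φ e) - φ w) * X -
      ((X - φ (E b)) * (-(X * φ e) - φ w) + (X * φ s + φ r) * φ a +
        (-(X * φ (E ((b • E) a))) - φ w')) =
      X * φ (a * s - (b • E) e - E b * e - s * a + E ((b • E) a)) +
        φ ((b • E) a * s + a * r - (b • E) w - (b • E) (E b) * e - E b * w - r * a + w') := by
    simp only [mul_sub, sub_mul, mul_neg, neg_mul, mul_assoc, h3, h4]
    simp only [mul_add, add_mul, ← mul_assoc, h1, h5, map_add, map_sub, map_mul, mul_sub]
    abel
  rw [hDX, hDa, hDδ, ← sub_eq_zero, key]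
  have hu : a * s - (b • E) e - E b * e - s * a + E ((b • E) a) = 0 := by
    simp only [Derivation.leibniz, smul_eq_mul, Derivation.smul_apply]
    rw [← he]
    ring
  have hv : (b • E) a * s + a * r - (b • E) w - (b • E) (E b) * e - E b * w - r * a + w' = 0 := by
    have hq := two_mul_chooseTwo E h2 a
    rw [hw', hw, hs]
    simp only [Derivation.leibniz, smul_eq_mul, Derivation.smul_apply, chooseTwo_mul E h2, map_add,
      derivation_chooseTwo]
    rw [← he] at hq ⊢
    linear_combination (-e) * hcond - b * E b * hq
  rw [hu, hv, map_zero, mul_zero, add_zero]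

/-- The algebra homomorphism `z ↦ (σ(z), D(z); 0, z)`, which encodes an endomorphism `σ` of
`A[x; δ]` and a `σ`-derivation `D`. -/
def skewMat (h2 : (2 : F) ≠ 0) (hcond : b * (α + E c - chooseTwo E b - E b) = 0) :
    Ore (b • E) →ₐ[F] Matrix (Fin 2) (Fin 2) (Ore (b • E)) :=
  oreLift (skewMatC E b c h2)
    !![oreX (b • E) - oreC (b • E) (E b), skewDerX E b c α κ; 0, oreX (b • E)] (by
      intro a
      have h1 := oreC_mul_oreX (b • E) a
      have h3 : oreC (b • E) a * oreC (b • E) (E b) = oreC (b • E) (E b) * oreC (b • E) a := by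
        rw [← map_mul, ← map_mul, mul_comm]
      have h4 := skewMat_cross E b c α κ h2 hcond a
      ext i j
      fin_cases i <;> fin_cases j
      · simp [Matrix.mul_apply, Fin.sum_univ_two, skewMatC, mul_sub, sub_mul, h1, h3]
        abel
      · simpa [Matrix.mul_apply, Fin.sum_univ_two, skewMatC] using h4
      · simp [Matrix.mul_apply, Fin.sum_univ_two, skewMatC]
      · simpa [Matrix.mul_apply, Fin.sum_univ_two, skewMatC] using h1)

end SkewDerivation

section SkewAction

variable {F A : Type*} [Field F] [CommRing A] [Algebra F A]
variable {E : Derivation F A A} {b c α : A} (κ : A) (h2 : (2 : F) ≠ 0)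
  (hcond : b * (α + E c - chooseTwo E b - E b) = 0)

/-! ### The iterated extension of `A[x; δ]` by a second variable -/

theorem skewMat_oreC (a : A) : skewMat E b c α κ h2 hcond (oreC (b • E) a) =
    !![oreC (b • E) a, skewDerC E b c a; 0, oreC (b • E) a] :=
  oreLift_oreC _ _ _ a

theorem skewMat_oreX : skewMat E b c α κ h2 hcond (oreX (b • E)) =
    !![oreX (b • E) - oreC (b • E) (E b), skewDerX E b c α κ; 0, oreX (b • E)] :=
  oreLift_oreX _ _ _

theorem skewMat_lower (z : Ore (b • E)) :
    skewMat E b c α κ h2 hcond z 1 0 = 0 ∧ skewMat E b c α κ h2 hcond z 1 1 = z := by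
  induction z using ore_induction with
  | hX => simp [skewMat_oreX]
  | hC a => simp [skewMat_oreC]
  | hadd x y hx hy => simp [hx, hy]
  | hmul x y hx hy => simp [Matrix.mul_apply, Fin.sum_univ_two, hx, hy]

/-- Left multiplication by `y` on `∑ zₙ yⁿ`, where `y z = σ(z) y + D(z)`. -/
def skewShift : Module.End F (ℕ → Ore (b • E)) where
  toFun m n := (match n with
    | 0 => 0
    | k + 1 => skewMat E b c α κ h2 hcond (m k) 0 0) + skewMat E b c α κ h2 hcond (m n) 0 1
  map_add' m m' := by
    funext n
    cases n
    · simp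
    · simp
      abel
  map_smul' r m := by
    funext n
    cases n <;> simp

theorem skewShift_zero (m : ℕ → Ore (b • E)) :
    skewShift κ h2 hcond m 0 =
      skewMat E b c α κ h2 hcond (m 0) 0 1 := by
  simp [skewShift]

theorem skewShift_succ (m : ℕ → Ore (b • E)) (n : ℕ) :
    skewShift κ h2 hcond m (n + 1) =
      skewMat E b c α κ h2 hcond (m n) 0 0 + skewMat E b c α κ h2 hcond (m (n + 1)) 0 1 := by
  simp [skewShift]

theorem skewShift_mul_lsmul (z : Ore (b • E)) :
    skewShift κ h2 hcond * Algebra.lsmul F F (ℕ → Ore (b • E)) z =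
      Algebra.lsmul F F (ℕ → Ore (b • E)) (skewMat E b c α κ h2 hcond z 0 0) *
          skewShift κ h2 hcond +
        Algebra.lsmul F F (ℕ → Ore (b • E)) (skewMat E b c α κ h2 hcond z 0 1) := by
  have hmul : ∀ u : Ore (b • E), skewMat E b c α κ h2 hcond (z * u) 0 0 =
      skewMat E b c α κ h2 hcond z 0 0 * skewMat E b c α κ h2 hcond u 0 0 := fun u => by
    rw [map_mul, Matrix.mul_apply, Fin.sum_univ_two, (skewMat_lower κ h2 hcond u).1, mul_zero,
      add_zero]
  have hmul' : ∀ u : Ore (b • E), skewMat E b c α κ h2 hcond (z * u) 0 1 =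
      skewMat E b c α κ h2 hcond z 0 0 * skewMat E b c α κ h2 hcond u 0 1 +
        skewMat E b c α κ h2 hcond z 0 1 * u := fun u => by
    rw [map_mul, Matrix.mul_apply, Fin.sum_univ_two, (skewMat_lower κ h2 hcond u).2]
  refine LinearMap.ext fun m => funext fun n => ?_
  cases n with
  | zero => simp [skewShift_zero, hmul']
  | succ n =>
    simp [skewShift_succ, hmul, hmul', mul_add]
    abel

theorem skewShift_single (j : ℕ) :
    skewShift κ h2 hcond (Pi.single j 1) = Pi.single (j + 1) 1 := by
  have h1 : ∀ q : Prop, ∀ [Decidable q],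
      skewMat E b c α κ h2 hcond (if q then 1 else 0) 0 1 = 0 := by
    intro q _
    split_ifs <;> simp
  have h0 : ∀ q : Prop, ∀ [Decidable q],
      skewMat E b c α κ h2 hcond (if q then 1 else 0) 0 0 = if q then 1 else 0 := by
    intro q _
    split_ifs <;> simp
  funext n
  cases n with
  | zero => simp [skewShift_zero, Pi.single_apply, h1]
  | succ n => simp [skewShift_succ, Pi.single_apply, h1, h0]

/-- The commutation relation between the two variables. -/
theorem lsmul_oreX_mul_skewShift :
    Algebra.lsmul F F (ℕ → Ore (b • E)) (oreX (b • E)) *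
        skewShift κ h2 hcond =
      skewShift κ h2 hcond * Algebra.lsmul F F (ℕ → Ore (b • E)) (oreX (b • E)) +
        (Algebra.lsmul F F (ℕ → Ore (b • E)) (oreC (b • E) κ) +
          (Algebra.lsmul F F (ℕ → Ore (b • E)) (oreX (b • E)) *
            Algebra.lsmul F F (ℕ → Ore (b • E)) (oreC (b • E) α) +
          skewShift κ h2 hcond * Algebra.lsmul F F (ℕ → Ore (b • E)) (oreC (b • E) (E b)))) := by
  rw [skewShift_mul_lsmul, skewShift_mul_lsmul, skewMat_oreX, skewMat_oreC]
  simp only [Matrix.of_apply, Matrix.cons_val_zero, Matrix.cons_val_one, skewDerX, map_sub,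
    map_neg, map_mul, sub_mul]
  abel

end SkewAction

section Transvection

variable (p : ℕ) [Fact p.Prime]

/-! ### The transvection group and its group algebra -/

/-- The subgroup of all transvections fixing `v₁`, with matrices `(1 t; 0 1)`. -/
def upperTransvections : Subgroup (LinearMap.GeneralLinearGroup (ZMod p) (Plane p)) where
  carrier := {h | ∃ t : ZMod p, ∀ v : Plane p,
    (h : Plane p →ₗ[ZMod p] Plane p) v = ![v 0 + t * v 1, v 1]}
  one_mem' := ⟨0, fun v => by
    ext i
    fin_cases i <;> simp⟩
  mul_mem' := by
    rintro h k ⟨s, hs⟩ ⟨t, ht⟩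
    refine ⟨s + t, fun v => ?_⟩
    rw [Units.val_mul, Module.End.mul_apply, ht, hs]
    ext i
    fin_cases i
    · simp
      ring
    · simp
  inv_mem' := by
    rintro h ⟨t, ht⟩
    refine ⟨-t, fun v => ?_⟩
    have h1 : (h : Plane p →ₗ[ZMod p] Plane p) ![v 0 + -t * v 1, v 1] = v := by
      rw [ht]
      ext i
      fin_cases i <;> simp
    conv_lhs => rw [← h1]
    rw [← Module.End.mul_apply, ← Units.val_mul, inv_mul_cancel]
    rfl

theorem transvection_apply (v : Plane p) :
    (transvection p : Plane p →ₗ[ZMod p] Plane p) v = ![v 0 + v 1, v 1] := by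
  ext i
  fin_cases i <;>
    simp [transvection, Matrix.GeneralLinearGroup.toLin, Matrix.GeneralLinearGroup.mkOfDetNeZero,
      Matrix.mulVec, dotProduct, Fin.sum_univ_two]

variable {p}

/-- The coefficient `e(h)` in `h v₂ = e(h) v₁ + v₂`. -/
def shear (h : Grp p) : ZMod p := (h • v₂ p) 0

theorem grp_smul (h : Grp p) (v : Plane p) : h • v = ![v 0 + shear h * v 1, v 1] := by
  have hle : Subgroup.zpowers (transvection p) ≤ upperTransvections p := by
    rw [Subgroup.zpowers_le]
    exact ⟨1, fun v => by rw [transvection_apply, one_mul]⟩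
  obtain ⟨t, ht⟩ := hle h.2
  have ht' : ∀ v : Plane p, h • v = ![v 0 + t * v 1, v 1] := ht
  have : shear h = t := by
    rw [shear, ht']
    simp [v₂]
  rw [this, ht']

theorem shear_mul (h k : Grp p) : shear (h * k) = shear h + shear k := by
  rw [shear, mul_smul, grp_smul k, grp_smul h]
  simp [v₂]
  ring

theorem shear_one : shear (1 : Grp p) = 0 := by
  rw [shear, one_smul]
  simp [v₂]

theorem shear_gen : shear (gen p) = 1 := by
  have h : gen p • v₂ p = ![v₂ p 0 + v₂ p 1, v₂ p 1] := transvection_apply p _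
  rw [shear, h]
  simp [v₂]

theorem shear_gen_pow (i : ℕ) : shear (gen p ^ i) = i := by
  induction i with
  | zero => simp [shear_one]
  | succ i ih => rw [pow_succ, shear_mul, ih, shear_gen, Nat.cast_succ]

theorem shear_injective : Function.Injective (shear (p := p)) := by
  intro h k hk
  refine Subtype.ext (Units.ext (LinearMap.ext fun v => ?_))
  change h • v = k • v
  rw [grp_smul, grp_smul, hk]

theorem gen_pow_val (h : Grp p) : gen p ^ (shear h).val = h :=
  shear_injective (by rw [shear_gen_pow, ZMod.natCast_zmod_val])

variable (p) in
/-- The group is isomorphic to `ℤ/p` through `e`. -/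
def shearEquiv : Grp p ≃ ZMod p where
  toFun := shear
  invFun t := gen p ^ t.val
  left_inv := gen_pow_val
  right_inv t := by rw [shear_gen_pow, ZMod.natCast_zmod_val]

instance : Finite (Grp p) := Finite.of_equiv _ (shearEquiv p).symm

/-! The group is commutative, and so is its group algebra. These instances are scoped, so that the
structures on `Grp p` and `GrpAlg p` elsewhere are those inherited from the general linear group. -/

namespace Transvection

scoped instance : CommGroup (Grp p) :=
  { (inferInstance : Group (Grp p)) with
    mul_comm := fun h k => shear_injective (by rw [shear_mul, shear_mul, add_comm]) }

-- shortcut instances for the group algebra, which speed up instance resolution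

scoped instance : CommRing (GrpAlg p) := MonoidAlgebra.commRing

scoped instance : CommSemiring (GrpAlg p) := MonoidAlgebra.commSemiring

scoped instance : Ring (GrpAlg p) := MonoidAlgebra.ring

scoped instance : Semiring (GrpAlg p) := MonoidAlgebra.semiring

scoped instance : AddCommGroup (GrpAlg p) := MonoidAlgebra.addCommGroup

scoped instance : AddCommMonoid (GrpAlg p) := MonoidAlgebra.instAddCommMonoid

scoped instance : AddMonoid (GrpAlg p) := MonoidAlgebra.instAddMonoid

scoped instance : Sub (GrpAlg p) := inferInstance

scoped instance : Add (GrpAlg p) := inferInstance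

scoped instance : Mul (GrpAlg p) := inferInstance

scoped instance : Zero (GrpAlg p) := inferInstance

scoped instance : Algebra (ZMod p) (GrpAlg p) := MonoidAlgebra.algebra

scoped instance : Module (ZMod p) (GrpAlg p) := inferInstance

end Transvection

end Transvection

section Standard

open scoped Transvection

variable {p : ℕ} [Fact p.Prime]

/-! ### The standard parameter functions -/

variable (p) in
/-- The Euler derivation `h ↦ e(h) h` of the group algebra. -/
def euler : Derivation (ZMod p) (GrpAlg p) (GrpAlg p) :=
  Derivation.mk'
    ((Finsupp.lsum (ZMod p) fun h => LinearMap.toSpanSingleton (ZMod p) (GrpAlg p)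
      (MonoidAlgebra.single h (shear h))) ∘ₗ (MonoidAlgebra.coeffLinearEquiv (ZMod p)).toLinearMap)
    (by
      intro x y
      induction x using MonoidAlgebra.induction_linear with
      | zero => simp
      | add a b ha hb =>
        rw [add_mul, map_add, ha, hb, map_add]
        simp only [smul_eq_mul]
        ring
      | single h r =>
        induction y using MonoidAlgebra.induction_linear with
        | zero => simp
        | add a b ha hb =>
          rw [mul_add, map_add, ha, hb, map_add]
          simp only [smul_eq_mul]
          ring
        | single k s =>
          simp only [MonoidAlgebra.single_mul_single, LinearMap.comp_apply,
            LinearEquiv.coe_coe, MonoidAlgebra.coeffLinearEquiv_apply, MonoidAlgebra.coeff_single,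
            Finsupp.lsum_single, LinearMap.toSpanSingleton_apply, MonoidAlgebra.smul_single,
            smul_eq_mul, shear_mul, mul_comm k h]
          rw [← MonoidAlgebra.single_add]
          congr 1
          ring)

theorem euler_single (h : Grp p) (r : ZMod p) :
    euler p (MonoidAlgebra.single h r) = MonoidAlgebra.single h (shear h * r) := by
  change ((Finsupp.lsum (ZMod p) fun h => LinearMap.toSpanSingleton (ZMod p) (GrpAlg p)
      (MonoidAlgebra.single h (shear h))) ∘ₗ
        (MonoidAlgebra.coeffLinearEquiv (ZMod p)).toLinearMap) _ = _
  simp [mul_comm]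

theorem euler_of (h : Grp p) : euler p (MonoidAlgebra.of (ZMod p) (Grp p) h) =
    shear h • MonoidAlgebra.of (ZMod p) (Grp p) h := by
  rw [MonoidAlgebra.of_apply, euler_single, MonoidAlgebra.smul_single, smul_eq_mul]

theorem two_ne_zero_zmod (hp : p ≠ 2) : (2 : ZMod p) ≠ 0 := by
  have h : ((2 : ℕ) : ZMod p) ≠ 0 := by
    rw [Ne, ZMod.natCast_eq_zero_iff, Nat.prime_dvd_prime_iff_eq (Fact.out) Nat.prime_two]
    exact hp
  exact_mod_cast h

/-- The parameter functions with `λ(h, v₁) = e(h) b h`,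
`λ(h, v₂) = (e(h) choose 2) b h + e(h) c h` and `κ(v₁, v₂) = κ^C + v₁ α + v₂ β`, where `β` is the
image of `b` under the Euler derivation. -/
def stdParams (b c α κC : GrpAlg p) : Params (ZMod p) (Plane p) (Grp p) where
  lam := LinearMap.mk₂ (ZMod p)
    (fun a v => v 0 • (b * euler p a) + v 1 • (b * chooseTwo (euler p) a + c * euler p a))
    (fun a a' v => by simp only [map_add, mul_add, smul_add]; abel)
    (fun r a v => by
      simp only [Derivation.map_smul, map_smul, mul_smul_comm, smul_add, smul_comm r])
    (fun a v w => by simp only [Pi.add_apply, add_smul]; abel)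
    (fun r a v => by simp only [Pi.smul_apply, smul_eq_mul, mul_smul, smul_add])
  kap := LinearMap.mk₂ (ZMod p)
    (fun v w => (v 0 * w 1 - v 1 * w 0) • (κC, v₁ p ⊗ₜ α + v₂ p ⊗ₜ euler p b))
    (fun a a' v => by rw [← add_smul]; congr 1; simp only [Pi.add_apply]; ring)
    (fun r a v => by rw [smul_smul]; congr 1; simp only [Pi.smul_apply, smul_eq_mul]; ring)
    (fun a v w => by rw [← add_smul]; congr 1; simp only [Pi.add_apply]; ring)
    (fun r a v => by rw [smul_smul]; congr 1; simp only [Pi.smul_apply, smul_eq_mul]; ring)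

theorem stdParams_lam (b c α κC a : GrpAlg p) (v : Plane p) : (stdParams b c α κC).lam a v =
    v 0 • (b * euler p a) + v 1 • (b * chooseTwo (euler p) a + c * euler p a) := rfl

theorem stdParams_kap (b c α κC : GrpAlg p) (v w : Plane p) : (stdParams b c α κC).kap v w =
    (v 0 * w 1 - v 1 * w 0) • (κC, v₁ p ⊗ₜ α + v₂ p ⊗ₜ euler p b) := rfl

/-! ### The representation of `H_{λ,κ}` -/

section Lift

variable {R : Type*} [Ring R] [Algebra (ZMod p) R] (Φ : GrpAlg p →ₐ[ZMod p] R) (X Y : R)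

/-- The homomorphism of the free algebra given by the images of `F[G]`, `v₁` and `v₂`. -/
def wordsLift : Words (ZMod p) (Plane p) (Grp p) →ₐ[ZMod p] R :=
  TensorAlgebra.lift (ZMod p)
    (((LinearMap.proj 0 : Plane p →ₗ[ZMod p] ZMod p).smulRight X +
      (LinearMap.proj 1 : Plane p →ₗ[ZMod p] ZMod p).smulRight Y).coprod Φ.toLinearMap)

theorem wordsLift_vec (v : Plane p) :
    wordsLift Φ X Y (vec (ZMod p) (Plane p) (Grp p) v) = v 0 • X + v 1 • Y := by
  simp [wordsLift, vec]

theorem wordsLift_grp (a : GrpAlg p) :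
    wordsLift Φ X Y (grp (ZMod p) (Plane p) (Grp p) a) = Φ a := by
  simp [wordsLift, grp]

variable {Φ X Y} {b c α κC : GrpAlg p}
  (hX : ∀ a, Φ a * X = X * Φ a + Φ (b * euler p a))
  (hY : ∀ a, Φ a * Y = Y * Φ a + X * Φ (euler p a) +
    Φ (b * chooseTwo (euler p) a + c * euler p a))
  (hXY : X * Y = Y * X + (Φ κC + (X * Φ α + Y * Φ (euler p b))))

include hX hY hXY in
theorem wordsLift_rel {u w : Words (ZMod p) (Plane p) (Grp p)}
    (h : Rel (stdParams b c α κC) u w) : wordsLift Φ X Y u = wordsLift Φ X Y w := by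
  induction h with
  | one => rw [wordsLift_grp, map_one, map_one]
  | mul x y => rw [map_mul (wordsLift Φ X Y), wordsLift_grp, wordsLift_grp, wordsLift_grp, map_mul]
  | cross h v =>
    rw [map_mul, map_add, map_mul, wordsLift_grp, wordsLift_grp, wordsLift_vec, wordsLift_vec,
      stdParams_lam, grp_smul, mul_add, mul_smul_comm, mul_smul_comm, hX, hY, euler_of, map_smul]
    simp only [Matrix.cons_val_zero, Matrix.cons_val_one, add_mul, add_smul, smul_mul_assoc,
      smul_add, map_add, map_smul, mul_smul_comm, mul_smul, smul_comm (shear h) (v 1)]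
    abel
  | comm v w =>
    have hlow : wordsLift Φ X Y (lowDegree (ZMod p) (Plane p) (Grp p)
        (κC, v₁ p ⊗ₜ α + v₂ p ⊗ₜ euler p b)) =
        Φ κC + (X * Φ α + Y * Φ (euler p b)) := by
      simp [lowDegree, wordsLift_grp, wordsLift_vec, v₁, v₂]
    rw [map_mul, map_add, map_mul, stdParams_kap, map_smul, map_smul, hlow, wordsLift_vec,
      wordsLift_vec, ← sub_eq_iff_eq_add'.2 hXY]
    simp only [mul_add, add_mul, smul_mul_assoc, mul_smul_comm]
    module

/-- The universal property of `H_{λ,κ}` for the standard parameter functions. -/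
def stdLift : H (stdParams b c α κC) →ₐ[ZMod p] R :=
  RingQuot.liftAlgHom (ZMod p) ⟨wordsLift Φ X Y, fun _ _ h => wordsLift_rel hX hY hXY h⟩

theorem stdLift_hgrp (a : GrpAlg p) : stdLift hX hY hXY (hgrp _ a) = Φ a :=
  (RingQuot.liftAlgHom_mkAlgHom_apply (ZMod p) _ _ _).trans (wordsLift_grp Φ X Y a)

theorem stdLift_hvec (v : Plane p) : stdLift hX hY hXY (hvec _ v) = v 0 • X + v 1 • Y :=
  (RingQuot.liftAlgHom_mkAlgHom_apply (ZMod p) _ _ _).trans (wordsLift_vec Φ X Y v)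

end Lift

section Coefficients

variable {b c α : GrpAlg p} (κC : GrpAlg p) (h2 : (2 : ZMod p) ≠ 0)
  (hcond : b * (α + euler p c - chooseTwo (euler p) b - euler p b) = 0)

variable (b) in
/-- Left multiplication by `A[x; δ]` on series `∑ zₙ yⁿ`. -/
def oreAct : Ore (b • euler p) →ₐ[ZMod p] Module.End (ZMod p) (ℕ → Ore (b • euler p)) :=
  Algebra.lsmul (ZMod p) (ZMod p) (ℕ → Ore (b • euler p))

variable (b) in
theorem oreAct_cross (a : GrpAlg p) :
    (oreAct b).comp (oreC (b • euler p)) a * oreAct b (oreX (b • euler p)) =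
      oreAct b (oreX (b • euler p)) * (oreAct b).comp (oreC (b • euler p)) a +
        (oreAct b).comp (oreC (b • euler p)) (b * euler p a) := by
  have h := congrArg (oreAct b) (oreC_mul_oreX (b • euler p) a)
  rwa [map_mul, map_add, map_mul] at h

theorem oreAct_mul_skewShift (a : GrpAlg p) :
    (oreAct b).comp (oreC (b • euler p)) a * skewShift κC h2 hcond =
      skewShift κC h2 hcond * (oreAct b).comp (oreC (b • euler p)) a +
      oreAct b (oreX (b • euler p)) * (oreAct b).comp (oreC (b • euler p)) (euler p a) +
        (oreAct b).comp (oreC (b • euler p)) (b * chooseTwo (euler p) a + c * euler p a) := by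
  have h : _ = oreAct b _ * _ + oreAct b _ :=
    skewShift_mul_lsmul κC h2 hcond (oreC (b • euler p) a)
  rw [skewMat_oreC] at h
  simp only [Matrix.of_apply, Matrix.cons_val_zero, Matrix.cons_val_one, skewDerC_apply,
    map_sub (oreAct b), map_neg (oreAct b), map_mul (oreAct b)] at h
  simp only [AlgHom.comp_apply]
  refine Eq.trans ?_ (congrArg (· + _ + _) h.symm)
  abel

/-- The action of `H_{λ,κ}` on series `∑ zₙ yⁿ` over `A[x; δ]`, in which `v₁` acts as `x` and `v₂`
as `y`. -/
def hAct : H (stdParams b c α κC) →ₐ[ZMod p] Module.End (ZMod p) (ℕ → Ore (b • euler p)) :=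
  stdLift (Φ := (oreAct b).comp (oreC (b • euler p))) (oreAct_cross b)
    (oreAct_mul_skewShift κC h2 hcond) (lsmul_oreX_mul_skewShift κC h2 hcond)

/-- The coefficients of an element of `H_{λ,κ}` with respect to the monomials `v₁ⁱ v₂ʲ`. -/
def hCoeff (j i : ℕ) : H (stdParams b c α κC) →ₗ[ZMod p] GrpAlg p where
  toFun z := oreRep (b • euler p) (hAct κC h2 hcond z (Pi.single 0 1) j) (Pi.single 0 1) i
  map_add' x y := by simp
  map_smul' r x := by simp

theorem hAct_hgrp (a : GrpAlg p) :
    hAct κC h2 hcond (hgrp _ a) = oreAct b (oreC (b • euler p) a) :=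
  stdLift_hgrp _ _ _ a

theorem hAct_hvec₁ : hAct κC h2 hcond (hvec _ (v₁ p)) = oreAct b (oreX (b • euler p)) := by
  refine (stdLift_hvec _ _ _ _).trans ?_
  simp [v₁]

theorem hAct_hvec₂ : hAct κC h2 hcond (hvec _ (v₂ p)) = skewShift κC h2 hcond := by
  refine (stdLift_hvec _ _ _ _).trans ?_
  simp [v₂]

theorem skewShift_pow_single (j : ℕ) :
    (skewShift κC h2 hcond ^ j) (Pi.single 0 1) = Pi.single j 1 := by
  induction j with
  | zero => simp
  | succ j ih => rw [pow_succ', Module.End.mul_apply, ih, skewShift_single]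

theorem hAct_monomial (a : GrpAlg p) (i j : ℕ) :
    hAct κC h2 hcond (hgrp _ a * hvec _ (v₁ p) ^ i * hvec _ (v₂ p) ^ j) (Pi.single 0 1) =
      Pi.single j (oreC (b • euler p) a * oreX (b • euler p) ^ i) := by
  have h : hAct κC h2 hcond (hgrp _ a * hvec _ (v₁ p) ^ i * hvec _ (v₂ p) ^ j) =
      oreAct b (oreC (b • euler p) a * oreX (b • euler p) ^ i) * skewShift κC h2 hcond ^ j := by
    rw [map_mul (hAct κC h2 hcond), map_mul (hAct κC h2 hcond), map_pow (hAct κC h2 hcond),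
      map_pow (hAct κC h2 hcond), hAct_hgrp, hAct_hvec₁, hAct_hvec₂, map_mul (oreAct b),
      map_pow (oreAct b)]
  have h' : ∀ z : Ore (b • euler p), oreAct b z (Pi.single j 1) = Pi.single j z := fun z => by
    funext n
    by_cases hn : n = j <;> simp [hn, oreAct]
  rw [h, Module.End.mul_apply, skewShift_pow_single, h']

theorem hCoeff_monomial (a : GrpAlg p) (i j i' j' : ℕ) :
    hCoeff κC h2 hcond j' i' (hgrp _ a * hvec _ (v₁ p) ^ i * hvec _ (v₂ p) ^ j) =
      if i = i' ∧ j = j' then a else 0 := by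
  change oreRep (b • euler p) (hAct κC h2 hcond _ (Pi.single 0 1) j') (Pi.single 0 1) i' = _
  rw [hAct_monomial]
  by_cases hj : j = j'
  · subst hj
    rw [Pi.single_eq_same, oreRep_monomial]
    by_cases hi : i = i' <;> simp [hi, eq_comm]
  · rw [Pi.single_eq_of_ne' hj]
    simp [hj]

end Coefficients

end Standard

section SkewLeft

variable {F V G : Type*} [Field F] [AddCommGroup V] [Module F V] [Group G]
  [DistribMulAction G V] [SMulCommClass G F V]

/-- The map `(s, x) ↦ x s` to `S(V) ⋊ G`, with the element of the group algebra on the left. -/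
def skewLeft : SymmetricAlgebra F V →ₗ[F] MonoidAlgebra F G →ₗ[F] SkewGroupAlgebra F V G :=
  LinearMap.mk₂ F (fun s x => skewZero x * SkewMonoidAlgebra.single 1 s)
    (fun s t x => by rw [SkewMonoidAlgebra.single_add, mul_add])
    (fun r s x => by
      have h : SkewMonoidAlgebra.single (1 : G) (r • s) = r • SkewMonoidAlgebra.single 1 s :=
        (SkewMonoidAlgebra.smul_single r _ s).symm
      rw [h, mul_smul_comm])
    (fun s x y => by rw [map_add, add_mul])
    (fun r s x => by rw [map_smul, smul_mul_assoc])

theorem skewLeft_apply (s : SymmetricAlgebra F V) (x : MonoidAlgebra F G) :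
    skewLeft s x = skewZero x * SkewMonoidAlgebra.single 1 s := rfl

theorem single_eq_skewLeft (h : G) (s : SymmetricAlgebra F V) :
    SkewMonoidAlgebra.single h s = skewLeft (h⁻¹ • s) (MonoidAlgebra.single h (1 : F)) := by
  rw [skewLeft_apply, skewZero_single, one_smul, SkewMonoidAlgebra.single_mul_single,
    smul_inv_smul, mul_one, one_mul]

theorem toGr_skewLeft (P : Params F V G) (s : SymmetricAlgebra F V) (x : MonoidAlgebra F G) :
    toGr P (skewLeft s x) = symb P 0 ⟨hgrp P x, hgrp_mem P x⟩ *
      symLift (grVec P) (grVec_mul_grVec P) s := by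
  rw [skewLeft_apply, toGr_mul, toGr_skewZero, toGr_single, map_one, mul_one]

end SkewLeft

section Sufficiency

open scoped Transvection

variable {p : ℕ} [Fact p.Prime]

/-! ### The Poincaré–Birkhoff–Witt property for the standard parameter functions -/

variable (p) in
/-- The monomials `v₁ⁱ v₂ⁿ⁻ⁱ` of `S(V)`. -/
def symMonomial (n i : ℕ) : SymmetricAlgebra (ZMod p) (Plane p) :=
  SymmetricAlgebra.ι (ZMod p) _ (v₁ p) ^ i * SymmetricAlgebra.ι (ZMod p) _ (v₂ p) ^ (n - i)

theorem plane_eq (v : Plane p) : v = v 0 • v₁ p + v 1 • v₂ p := by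
  ext i
  fin_cases i <;> simp [v₁, v₂]

theorem symOne_pow_le (n : ℕ) : symOne (ZMod p) (Plane p) ^ n ≤
    Submodule.span (ZMod p) (Set.range fun i : Fin (n + 1) => symMonomial p n i) := by
  induction n with
  | zero =>
    rw [pow_zero, Submodule.one_le]
    exact Submodule.subset_span ⟨0, by simp [symMonomial]⟩
  | succ n ih =>
    rw [pow_succ, Submodule.mul_le]
    rintro a ha _ ⟨v, rfl⟩
    have h : ∀ x ∈ Submodule.span (ZMod p) (Set.range fun i : Fin (n + 1) => symMonomial p n i),
        x * SymmetricAlgebra.ι (ZMod p) (Plane p) v ∈ Submodule.span (ZMod p)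
          (Set.range fun i : Fin (n + 1 + 1) => symMonomial p (n + 1) i) := by
      intro x hx
      induction hx using Submodule.span_induction with
      | zero => rw [zero_mul]; exact Submodule.zero_mem _
      | add x y _ _ hx hy => rw [add_mul]; exact Submodule.add_mem _ hx hy
      | smul r x _ hx => rw [smul_mul_assoc]; exact Submodule.smul_mem _ _ hx
      | mem x hx =>
        obtain ⟨i, rfl⟩ := hx
        rw [plane_eq v, map_add, map_smul, map_smul, mul_add, mul_smul_comm, mul_smul_comm]
        refine Submodule.add_mem _ (Submodule.smul_mem _ _ (Submodule.subset_span ⟨i.succ, ?_⟩))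
          (Submodule.smul_mem _ _ (Submodule.subset_span ⟨i.castSucc, ?_⟩))
        · simp only [symMonomial, Fin.val_succ, Nat.add_sub_add_right, pow_succ]
          ring
        · simp only [symMonomial, Fin.val_castSucc]
          rw [Nat.sub_add_comm (Nat.lt_succ_iff.1 i.2), pow_succ, mul_assoc]
    exact h a (ih ha)

/-- The element `∑ᵢ aᵢ v₁ⁱ v₂ⁿ⁻ⁱ` of `S(V) ⋊ G`. -/
def skewComb (n : ℕ) : (Fin (n + 1) → GrpAlg p) →ₗ[ZMod p]
    SkewGroupAlgebra (ZMod p) (Plane p) (Grp p) where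
  toFun a := ∑ i : Fin (n + 1), skewLeft (symMonomial p n i) (a i)
  map_add' a a' := by simp [Finset.sum_add_distrib]
  map_smul' r a := by simp [Finset.smul_sum]

theorem skewComb_surjective {n : ℕ} {z : SkewGroupAlgebra (ZMod p) (Plane p) (Grp p)}
    (hz : z ∈ skewDegree (ZMod p) (Plane p) (Grp p) n) : ∃ a, skewComb n a = z := by
  suffices h : skewDegree (ZMod p) (Plane p) (Grp p) n ≤ LinearMap.range (skewComb n) from h hz
  refine skewDegree_le fun h s hs => ?_
  have key : ∀ t ∈ Submodule.span (ZMod p) (Set.range fun i : Fin (n + 1) => symMonomial p n i),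
      skewLeft t (MonoidAlgebra.single h 1) ∈ LinearMap.range (skewComb (p := p) n) := by
    intro t ht
    induction ht using Submodule.span_induction with
    | zero => rw [map_zero]; exact Submodule.zero_mem _
    | add x y _ _ hx hy => rw [map_add]; exact Submodule.add_mem _ hx hy
    | smul r x _ hx => rw [map_smul]; exact Submodule.smul_mem _ _ hx
    | mem x hx =>
      obtain ⟨i, rfl⟩ := hx
      refine ⟨Pi.single i (MonoidAlgebra.single h 1), ?_⟩
      change ∑ j : Fin (n + 1), skewLeft (symMonomial p n j) _ = _
      rw [Finset.sum_eq_single i]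
      · rw [Pi.single_eq_same]
      · intro j _ hj
        rw [Pi.single_eq_of_ne hj, map_zero]
      · exact fun h => absurd (Finset.mem_univ _) h
  -- move the group element to the left of the polynomial
  rw [single_eq_skewLeft (F := ZMod p)]
  exact key _ (symOne_pow_le n (smul_mem_symOne_pow h⁻¹ hs))

variable (P : Params (ZMod p) (Plane p) (Grp p))

/-- The element `∑ᵢ aᵢ v₁ⁱ v₂ⁿ⁻ⁱ` of `H_{λ,κ}`. -/
def hComb (n : ℕ) (a : Fin (n + 1) → GrpAlg p) : H P :=
  ∑ i : Fin (n + 1), hgrp P (a i) * hvec P (v₁ p) ^ (i : ℕ) * hvec P (v₂ p) ^ (n - i)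

theorem hvec_pow_mem (v : Plane p) (i : ℕ) : hvec P v ^ i ∈ filtration P i := by
  have h := SetLike.pow_mem_graded (A := filtration P) i (hvec_mem P v)
  rwa [smul_eq_mul, mul_one] at h

theorem monomial_mem {n i : ℕ} (hi : i ≤ n) (a : GrpAlg p) :
    hgrp P a * hvec P (v₁ p) ^ i * hvec P (v₂ p) ^ (n - i) ∈ filtration P n := by
  have h1 := SetLike.mul_mem_graded (A := filtration P) (hgrp_mem P a) (hvec_pow_mem P (v₁ p) i)
  have h3 := SetLike.mul_mem_graded h1 (hvec_pow_mem P (v₂ p) (n - i))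
  rwa [zero_add, Nat.add_sub_cancel' hi] at h3

theorem hComb_mem (n : ℕ) (a : Fin (n + 1) → GrpAlg p) : hComb P n a ∈ filtration P n :=
  Submodule.sum_mem _ fun i _ => monomial_mem P (Nat.lt_succ_iff.1 i.2) (a i)

theorem grVec_pow (v : Plane p) (i : ℕ) :
    grVec P v ^ i = symb P i ⟨hvec P v ^ i, hvec_pow_mem P v i⟩ := by
  induction i with
  | zero =>
    rw [pow_zero, ← symb_one]
    exact symb_congr P rfl _ _ (pow_zero _).symm
  | succ i ih =>
    rw [pow_succ, ih]
    refine (symb_mul P _ ⟨hvec P v, hvec_mem P v⟩).trans ?_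
    exact symb_congr P rfl _ _ (pow_succ _ _).symm

theorem toGr_skewComb (n : ℕ) (a : Fin (n + 1) → GrpAlg p) :
    toGr P (skewComb n a) = symb P n ⟨hComb P n a, hComb_mem P n a⟩ := by
  have h1 : (⟨hComb P n a, hComb_mem P n a⟩ : filtration P n) = ∑ i : Fin (n + 1),
      ⟨_, monomial_mem P (Nat.lt_succ_iff.1 i.2) (a i)⟩ := by
    refine Subtype.ext ?_
    rw [AddSubmonoidClass.coe_finsetSum]
    rfl
  rw [h1, map_sum]
  change toGr P (∑ i, _) = _
  rw [map_sum]
  refine Finset.sum_congr rfl fun i _ => ?_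
  rw [toGr_skewLeft, symMonomial, map_mul, map_pow, map_pow, symLift_ι, symLift_ι, grVec_pow,
    grVec_pow, symb_mul]
  refine (symb_mul P _ _).trans (symb_congr P ?_ _ _ (mul_assoc _ _ _).symm)
  rw [zero_add, Nat.add_sub_cancel' (Nat.lt_succ_iff.1 i.2)]

/-- The monomials `v₁ⁱ v₂ⁿ⁻ⁱ` span the degree `n` part of `H_{λ,κ}` over `F[G]`, modulo lower
degree. -/
theorem exists_sub_hComb_mem {n : ℕ} {x : H P} (hx : x ∈ filtration P n) :
    ∃ a, x - hComb P n a ∈ prevStep (filtration P) n := by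
  obtain ⟨z, hz, hz'⟩ := exists_toGr_eq_symb P ⟨x, hx⟩
  obtain ⟨a, rfl⟩ := skewComb_surjective hz
  refine ⟨a, ?_⟩
  rw [toGr_skewComb, eq_comm, ← sub_eq_zero, ← map_sub, symb_eq_zero] at hz'
  exact hz'

variable {b c α : GrpAlg p} (κC : GrpAlg p) (h2 : (2 : ZMod p) ≠ 0)
  (hcond : b * (α + euler p c - chooseTwo (euler p) b - euler p b) = 0)

theorem hCoeff_hComb (n : ℕ) (a : Fin (n + 1) → GrpAlg p) (i j : ℕ) :
    hCoeff κC h2 hcond j i (hComb _ n a) =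
      ∑ k : Fin (n + 1), if (k : ℕ) = i ∧ n - k = j then a k else 0 := by
  rw [hComb, map_sum]
  exact Finset.sum_congr rfl fun k _ => hCoeff_monomial κC h2 hcond _ _ _ _ _

theorem hCoeff_eq_zero {n : ℕ} {x : H (stdParams b c α κC)} (hx : x ∈ filtration _ n) {i j : ℕ}
    (hij : n < i + j) : hCoeff κC h2 hcond j i x = 0 := by
  induction n generalizing x with
  | zero =>
    obtain ⟨a, ha⟩ := exists_sub_hComb_mem _ hx
    rw [sub_eq_zero.1 ((Submodule.mem_bot _).1 ha), hCoeff_hComb]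
    exact Finset.sum_eq_zero fun k _ => if_neg (by omega)
  | succ n ih =>
    obtain ⟨a, ha⟩ := exists_sub_hComb_mem _ hx
    rw [← sub_add_cancel x (hComb _ _ a), map_add, ih ha (by omega), zero_add, hCoeff_hComb]
    exact Finset.sum_eq_zero fun k _ => if_neg (by omega)

include h2 hcond in
/-- The monomials `v₁ⁱ v₂ʲ` of degree `n = i + j` are independent over `F[G]` modulo lower degree,
since the coefficients `hCoeff` of such a monomial vanish on all elements of lower degree. -/
theorem isDrinfeldOrbifoldAlgebra_stdParams :
    IsDrinfeldOrbifoldAlgebra (stdParams b c α κC) := by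
  rw [isDrinfeldOrbifoldAlgebra_iff]
  intro n z hz h
  obtain ⟨a, rfl⟩ := skewComb_surjective hz
  rw [toGr_skewComb, symb_eq_zero] at h
  have ha : a = 0 := by
    funext i
    have h1 : hCoeff κC h2 hcond (n - i) i (hComb _ n a) = a i := by
      rw [hCoeff_hComb, Finset.sum_eq_single i]
      · simp
      · exact fun k _ hk => if_neg fun hk' => hk (Fin.ext hk'.1)
      · exact fun h => absurd (Finset.mem_univ _) h
    rw [← h1]
    cases n with
    | zero =>
      have h3 : hComb (stdParams b c α κC) 0 a = 0 := h
      rw [h3, map_zero]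
      rfl
    | succ n => exact hCoeff_eq_zero κC h2 hcond h (by omega)
  rw [ha, map_zero]

end Sufficiency

section Necessity

open scoped Transvection

variable {p : ℕ} [Fact p.Prime]

/-! ### Every Drinfeld orbifold algebra has standard parameter functions -/

variable (p) in
/-- The coordinate maps `V ⊗ F[G] → F[G]` for the basis `v₁`, `v₂` of `V`. -/
def tensorCoord (i : Fin 2) : Plane p ⊗[ZMod p] GrpAlg p →ₗ[ZMod p] GrpAlg p :=
  TensorProduct.lift (LinearMap.lsmul (ZMod p) (GrpAlg p) ∘ₗ LinearMap.proj i)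

theorem tensorCoord_tmul (i : Fin 2) (v : Plane p) (x : GrpAlg p) :
    tensorCoord p i (v ⊗ₜ x) = v i • x := rfl

theorem eq_tensorCoord (t : Plane p ⊗[ZMod p] GrpAlg p) :
    t = v₁ p ⊗ₜ tensorCoord p 0 t + v₂ p ⊗ₜ tensorCoord p 1 t := by
  induction t with
  | zero => simp
  | add x y hx hy =>
    rw [map_add, map_add, TensorProduct.tmul_add, TensorProduct.tmul_add]
    nth_rw 1 [hx, hy]
    abel
  | tmul v x =>
    rw [tensorCoord_tmul, tensorCoord_tmul, ← TensorProduct.smul_tmul, ← TensorProduct.smul_tmul,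
      ← TensorProduct.add_tmul, ← plane_eq]

theorem of_gen_mul_right_cancel {x : GrpAlg p}
    (h : MonoidAlgebra.of (ZMod p) (Grp p) (gen p) * x = 0) : x = 0 := by
  have h1 : MonoidAlgebra.of (ZMod p) (Grp p) (gen p)⁻¹ *
      MonoidAlgebra.of (ZMod p) (Grp p) (gen p) = 1 := by
    rw [← map_mul, inv_mul_cancel, map_one]
  rw [← one_mul x, ← h1, mul_assoc, h, mul_zero]

/-- Every derivation of the group algebra is a multiple of the Euler derivation. -/
theorem exists_eq_mul_euler (D : Derivation (ZMod p) (GrpAlg p) (GrpAlg p)) :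
    ∃ b, ∀ a, D a = b * euler p a := by
  refine ⟨D (MonoidAlgebra.of (ZMod p) (Grp p) (gen p)) *
    MonoidAlgebra.of (ZMod p) (Grp p) (gen p)⁻¹, fun a => ?_⟩
  have h1 : MonoidAlgebra.of (ZMod p) (Grp p) (gen p)⁻¹ *
      MonoidAlgebra.of (ZMod p) (Grp p) (gen p) = 1 := by
    rw [← map_mul, inv_mul_cancel, map_one]
  induction a using MonoidAlgebra.induction_linear with
  | zero => rw [map_zero, map_zero, mul_zero]
  | add x y hx hy => rw [map_add, map_add, hx, hy, mul_add]
  | single h r =>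
    have h3 : MonoidAlgebra.single h r =
        r • MonoidAlgebra.of (ZMod p) (Grp p) (gen p) ^ (shear h).val := by
      rw [← map_pow, gen_pow_val, MonoidAlgebra.of_apply, MonoidAlgebra.smul_single, smul_eq_mul,
        mul_one]
    rw [h3, Derivation.map_smul, Derivation.map_smul, Derivation.leibniz_pow,
      Derivation.leibniz_pow, euler_of, shear_gen, one_smul]
    simp only [smul_eq_mul, mul_smul_comm]
    congr 2
    linear_combination (-(D (MonoidAlgebra.of (ZMod p) (Grp p) (gen p))) *
      MonoidAlgebra.of (ZMod p) (Grp p) (gen p) ^ ((shear h).val - 1)) * h1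

variable (P : Params (ZMod p) (Plane p) (Grp p))

theorem hgrp_mul_v₁ (a : GrpAlg p) : hgrp P a * hvec P (v₁ p) =
    hvec P (v₁ p) * hgrp P a + hgrp P (P.lam a (v₁ p)) := by
  induction a using MonoidAlgebra.induction_linear with
  | zero => simp
  | add x y hx hy =>
    rw [map_add, add_mul, hx, hy, map_add, mul_add, LinearMap.add_apply, map_add]
    abel
  | single h r =>
    have h1 : MonoidAlgebra.single h r = r • MonoidAlgebra.of (ZMod p) (Grp p) h := by
      rw [MonoidAlgebra.of_apply, MonoidAlgebra.smul_single, smul_eq_mul, mul_one]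
    have h3 : h • v₁ p = v₁ p := by
      rw [grp_smul]
      ext i
      fin_cases i <;> simp [v₁]
    rw [h1, map_smul, map_smul, LinearMap.smul_apply, map_smul, smul_mul_assoc, hgrp_mul_hvec, h3,
      smul_add, mul_smul_comm]

theorem hgrp_mul_v₂ (a : GrpAlg p) : hgrp P a * hvec P (v₂ p) =
    hvec P (v₂ p) * hgrp P a + hvec P (v₁ p) * hgrp P (euler p a) +
      hgrp P (P.lam a (v₂ p)) := by
  induction a using MonoidAlgebra.induction_linear with
  | zero => simp
  | add x y hx hy =>
    rw [map_add, add_mul, hx, hy, map_add, map_add, map_add, mul_add, mul_add,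
      LinearMap.add_apply, map_add]
    abel
  | single h r =>
    have h1 : MonoidAlgebra.single h r = r • MonoidAlgebra.of (ZMod p) (Grp p) h := by
      rw [MonoidAlgebra.of_apply, MonoidAlgebra.smul_single, smul_eq_mul, mul_one]
    have h3 : h • v₂ p = v₂ p + shear h • v₁ p := by
      rw [grp_smul]
      ext i
      fin_cases i <;> simp [v₁, v₂]
    rw [h1, map_smul, Derivation.map_smul, map_smul, map_smul, LinearMap.smul_apply, map_smul,
      smul_mul_assoc, hgrp_mul_hvec, h3, euler_of, map_smul, map_add, map_smul]
    simp only [smul_add, add_mul, mul_smul_comm, smul_mul_assoc]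

theorem hlow_apply (x y z : GrpAlg p) : hlow P (x, v₁ p ⊗ₜ y + v₂ p ⊗ₜ z) =
    hgrp P x + (hvec P (v₁ p) * hgrp P y + hvec P (v₂ p) * hgrp P z) := by
  have h : ((x, v₁ p ⊗ₜ y + v₂ p ⊗ₜ z) : GrpAlg p × Plane p ⊗[ZMod p] GrpAlg p) =
      (x, v₁ p ⊗ₜ y) + (0, v₂ p ⊗ₜ z) := by simp
  rw [h, map_add, hlow_tmul, hlow_tmul, map_zero, zero_add, add_assoc]

variable {P} (hP : IsDrinfeldOrbifoldAlgebra P)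
include hP

theorem eq_zero_of_low {x y z : GrpAlg p}
    (h : hgrp P x + (hvec P (v₁ p) * hgrp P y + hvec P (v₂ p) * hgrp P z) = 0) :
    x = 0 ∧ y = 0 ∧ z = 0 := by
  rw [← hlow_apply, ← map_zero (hlow P)] at h
  have h1 := hlow_injective P hP h
  have h3 : v₁ p ⊗ₜ y + v₂ p ⊗ₜ z = (0 : Plane p ⊗[ZMod p] GrpAlg p) := congrArg Prod.snd h1
  have h4 := congrArg (tensorCoord p 0) h3
  have h5 := congrArg (tensorCoord p 1) h3
  simp only [map_add, tensorCoord_tmul, map_zero] at h4 h5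
  exact ⟨congrArg Prod.fst h1, by simpa [v₁, v₂] using h4, by simpa [v₁, v₂] using h5⟩

/-- The map `λ(-, v₁)` is a derivation. -/
theorem lam_v₁_mul (x y : GrpAlg p) :
    P.lam (x * y) (v₁ p) = x * P.lam y (v₁ p) + P.lam x (v₁ p) * y := by
  refine hgrp_injective P hP ?_
  have h := hgrp_mul_v₁ P (x * y)
  rw [map_mul, mul_assoc, hgrp_mul_v₁ P y, mul_add, ← mul_assoc, hgrp_mul_v₁ P x, add_mul,
    mul_assoc, add_assoc] at h
  rw [map_add, map_mul (hgrp P), map_mul (hgrp P), ← add_left_cancel h, add_comm]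

/-- The failure of `λ(-, v₂)` to be a derivation is caused by `h v₂ = v₂ + e(h) v₁`. -/
theorem lam_v₂_mul (x y : GrpAlg p) :
    P.lam (x * y) (v₂ p) =
      x * P.lam y (v₂ p) + P.lam x (v₁ p) * euler p y + P.lam x (v₂ p) * y := by
  refine hgrp_injective P hP ?_
  have h := hgrp_mul_v₂ P (x * y)
  rw [map_mul, mul_assoc, hgrp_mul_v₂ P y, mul_add, mul_add, ← mul_assoc, ← mul_assoc,
    hgrp_mul_v₂ P x, hgrp_mul_v₁ P x] at h
  rw [← sub_eq_iff_eq_add'] at h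
  rw [← h, map_add, map_add, map_mul (hgrp P), map_mul (hgrp P), map_mul (hgrp P),
    Derivation.leibniz, smul_eq_mul, smul_eq_mul, mul_comm y, map_add, map_mul (hgrp P),
    map_mul (hgrp P)]
  simp only [mul_add, add_mul, mul_assoc]
  abel

variable {b c α κC : GrpAlg p}

/-- The two ways of reordering `g v₁ v₂` give two conditions on the parameter functions. -/
theorem overlap (h2 : (2 : ZMod p) ≠ 0) {β : GrpAlg p}
    (h₁ : ∀ a, P.lam a (v₁ p) = b * euler p a)
    (h₂ : ∀ a, P.lam a (v₂ p) = b * chooseTwo (euler p) a + c * euler p a)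
    (hκ : P.kap (v₁ p) (v₂ p) = (κC, v₁ p ⊗ₜ α + v₂ p ⊗ₜ β)) :
    β = euler p b ∧ b * (α + euler p c - chooseTwo (euler p) b - euler p b) = 0 := by
  obtain ⟨g, hg, hE⟩ : ∃ g : GrpAlg p, g = MonoidAlgebra.of (ZMod p) (Grp p) (gen p) ∧
    euler p g = g := ⟨_, rfl, by rw [euler_of, shear_gen, one_smul]⟩
  have hq : chooseTwo (euler p) g = 0 := by rw [chooseTwo_apply, hE, hE, sub_self, smul_zero]
  have hX : ∀ a, hgrp P a * hvec P (v₁ p) =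
      hvec P (v₁ p) * hgrp P a + hgrp P (b * euler p a) := fun a => by
    rw [hgrp_mul_v₁, h₁]
  have hY : ∀ a, hgrp P a * hvec P (v₂ p) =
      hvec P (v₂ p) * hgrp P a + hvec P (v₁ p) * hgrp P (euler p a) +
        hgrp P (b * chooseTwo (euler p) a + c * euler p a) := fun a => by
    rw [hgrp_mul_v₂, h₂]
  have hXY := hvec_mul_hvec P (v₁ p) (v₂ p)
  rw [hκ, hlow_apply] at hXY
  set X := hvec P (v₁ p)
  set Y := hvec P (v₂ p)
  have hgX : hgrp P g * X = X * hgrp P g + hgrp P (b * g) := by rw [hX, hE]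
  have hgY : hgrp P g * Y = Y * hgrp P g + X * hgrp P g + hgrp P (c * g) := by
    rw [hY, hE, hq, mul_zero, zero_add]
  have hl : hgrp P g * (X * Y) = (Y * X + (hgrp P κC + (X * hgrp P α + Y * hgrp P β))) * hgrp P g +
      X * (X * hgrp P g + hgrp P (c * g)) + (Y * hgrp P (b * g) + X * hgrp P (euler p (b * g)) +
        hgrp P (b * chooseTwo (euler p) (b * g) + c * euler p (b * g))) := by
    rw [← hXY, ← mul_assoc, hgX, add_mul, mul_assoc, hgY, hY]
    simp only [mul_add, mul_assoc]
    abel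
  have hr : hgrp P g * (Y * X + (hgrp P κC + (X * hgrp P α + Y * hgrp P β))) =
      Y * (X * hgrp P g + hgrp P (b * g)) + X * (X * hgrp P g + hgrp P (b * g)) +
      (X * hgrp P (c * g) + hgrp P (b * euler p (c * g))) + (hgrp P g * hgrp P κC +
        ((X * hgrp P g + hgrp P (b * g)) * hgrp P α +
          (Y * hgrp P g + X * hgrp P g + hgrp P (c * g)) * hgrp P β)) := by
    rw [mul_add, mul_add, mul_add, ← mul_assoc, ← mul_assoc, ← mul_assoc, hgY, add_mul _ _ X,
      add_mul _ _ X, mul_assoc Y, mul_assoc X, hX (c * g), hgX]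
  have h := eq_zero_of_low hP
    (x := κC * g + (b * chooseTwo (euler p) (b * g) + c * euler p (b * g)) - b * euler p (c * g) -
      g * κC - b * g * α - c * g * β)
    (y := α * g + c * g + euler p (b * g) - b * g - c * g - g * α - g * β)
    (z := β * g + b * g - b * g - g * β) (by
      have h3 := (sub_eq_zero.2 (hl.symm.trans ((congrArg (hgrp P g * ·) hXY).trans hr)))
      rw [← h3]
      simp only [map_add, map_sub, map_mul (hgrp P), mul_add, mul_sub, add_mul, mul_assoc]
      abel)
  have hb : euler p (b * g) = (euler p b + b) * g := by
    rw [Derivation.leibniz, hE, smul_eq_mul, smul_eq_mul]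
    ring
  have hc : euler p (c * g) = (euler p c + c) * g := by
    rw [Derivation.leibniz, hE, smul_eq_mul, smul_eq_mul]
    ring
  have hqb : chooseTwo (euler p) (b * g) = (chooseTwo (euler p) b + euler p b) * g := by
    rw [chooseTwo_mul (euler p) h2, hq, hE]
    ring
  have hβ : β = euler p b := by
    have h3 : g * (euler p b - β) = 0 := by
      rw [← h.2.1, hb]
      ring
    rw [hg] at h3
    exact (sub_eq_zero.1 (of_gen_mul_right_cancel h3)).symm
  refine ⟨hβ, ?_⟩
  have h3 : g * (b * (α + euler p c - chooseTwo (euler p) b - euler p b)) = 0 := by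
    rw [← neg_eq_zero, ← h.1, hb, hc, hqb, hβ]
    ring
  rw [hg] at h3
  exact of_gen_mul_right_cancel h3

/-- The parameter functions of a Drinfeld orbifold algebra are standard: `λ(-, v₁)` is a derivation,
hence a multiple `b E` of the Euler derivation, and then `λ(-, v₂) - b E (E - 1) / 2` is one. -/
theorem exists_eq_stdParams (h2 : (2 : ZMod p) ≠ 0) :
    ∃ b c α κC, P = stdParams b c α κC ∧
      b * (α + euler p c - chooseTwo (euler p) b - euler p b) = 0 := by
  obtain ⟨b, hb⟩ := exists_eq_mul_euler (Derivation.mk' (P.lam.flip (v₁ p)) fun x y => by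
    rw [LinearMap.flip_apply, lam_v₁_mul hP, smul_eq_mul, smul_eq_mul, mul_comm y]
    rfl)
  have h₁ : ∀ a, P.lam a (v₁ p) = b * euler p a := hb
  obtain ⟨c, hc⟩ := exists_eq_mul_euler (Derivation.mk' (P.lam.flip (v₂ p) -
      LinearMap.mulLeft (ZMod p) b ∘ₗ chooseTwo (euler p)) fun x y => by
    simp only [LinearMap.sub_apply, LinearMap.flip_apply, LinearMap.comp_apply,
      LinearMap.mulLeft_apply, lam_v₂_mul hP, h₁, smul_eq_mul, chooseTwo_mul (euler p) h2]
    ring)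
  have h₂ : ∀ a, P.lam a (v₂ p) = b * chooseTwo (euler p) a + c * euler p a := fun a => by
    rw [← hc a]
    exact (add_sub_cancel _ _).symm
  obtain ⟨⟨κC, t⟩, hκ⟩ : ∃ κ, P.kap (v₁ p) (v₂ p) = κ := ⟨_, rfl⟩
  rw [eq_tensorCoord t] at hκ
  obtain ⟨hβ, hcond⟩ := overlap hP h2 h₁ h₂ hκ
  refine ⟨b, c, tensorCoord p 0 t, κC, ?_, hcond⟩
  have hself : ∀ v, P.kap v v = 0 := fun v => by
    have h := hvec_mul_hvec P v v
    rw [left_eq_add] at h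
    exact hlow_injective P hP (h.trans (map_zero _).symm)
  have hswap : P.kap (v₂ p) (v₁ p) = -P.kap (v₁ p) (v₂ p) := by
    have h := hself (v₁ p + v₂ p)
    simp only [map_add, LinearMap.add_apply, hself, zero_add, add_zero] at h
    exact eq_neg_of_add_eq_zero_left h
  refine Params.ext (LinearMap.ext₂ fun a v => ?_) (LinearMap.ext₂ fun v w => ?_)
  · rw [stdParams_lam, ← h₁, ← h₂, ← map_smul, ← map_smul, ← map_add, ← plane_eq]
  · rw [stdParams_kap, ← hβ, ← hκ]
    conv_lhs => rw [plane_eq v, plane_eq w]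
    simp only [map_add, map_smul, LinearMap.add_apply, LinearMap.smul_apply, hself, hswap]
    module

end Necessity

section TruncatedPolynomial

/-! ### Annihilators in a truncated polynomial algebra -/

variable {F A : Type*} [Field F] [CommRing A] [Algebra F A]

/-- The map `d ↦ ∑ dₘ uⁿ⁻¹⁻ᵐ`, which parametrizes the annihilator of `uᵏ` if `uⁿ = 0`. -/
def powSum (u : A) (n k : ℕ) : (Fin k → F) →ₗ[F] A :=
  ∑ m : Fin k, (LinearMap.proj m : (Fin k → F) →ₗ[F] F).smulRight (u ^ (n - (m + 1)))

theorem powSum_apply (u : A) (n k : ℕ) (d : Fin k → F) :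
    powSum u n k d = ∑ m : Fin k, d m • u ^ (n - (m + 1)) := by
  simp [powSum]

theorem powSum_snoc (u : A) (n k : ℕ) (d : Fin k → F) (r : F) :
    powSum u n (k + 1) (Fin.snoc d r : Fin (k + 1) → F) =
      powSum u n k d + r • u ^ (n - (k + 1)) := by
  simp [powSum_apply, Fin.sum_univ_castSucc]

theorem pow_dvd_powSum (u : A) {n k : ℕ} (d : Fin k → F) : u ^ (n - k) ∣ powSum u n k d := by
  rw [powSum_apply]
  refine Finset.dvd_sum fun m _ => ?_
  rw [← mul_smul_one]
  exact dvd_mul_of_dvd_left (pow_dvd_pow u (by omega)) _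

variable {u : A} {ε : A →ₐ[F] F} (hε : ∀ x, ε x = 0 → u ∣ x)
include hε

theorem exists_eq_algebraMap_add (x : A) : ∃ y, x = algebraMap F A (ε x) + u * y := by
  obtain ⟨y, hy⟩ := hε (x - algebraMap F A (ε x)) (by simp)
  exact ⟨y, by rw [← hy]; ring⟩

variable {n : ℕ} (hn : u ^ n = 0)
include hn

theorem exists_powSum_eq {k : ℕ} (hk : k ≤ n) (x : A) :
    ∃ d : Fin k → F, powSum u n k d = u ^ (n - k) * x := by
  induction k generalizing x with
  | zero => exact ⟨0, by rw [Nat.sub_zero, hn, zero_mul, map_zero]⟩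
  | succ k ih =>
    obtain ⟨y, hy⟩ := exists_eq_algebraMap_add hε x
    obtain ⟨d, hd⟩ := ih (by omega) y
    refine ⟨Fin.snoc d (ε x), ?_⟩
    rw [powSum_snoc, hd]
    conv_rhs => rw [hy]
    have h : n - k = n - (k + 1) + 1 := by omega
    rw [h, pow_succ, Algebra.smul_def]
    ring

/-- Every element is a unit times a power of `u`. -/
theorem exists_eq_pow_mul (b : A) : ∃ k ≤ n, ∃ w, b = u ^ k * w ∧ ε w ≠ 0 := by
  have h : ∀ j ≤ n, (∃ k ≤ n, ∃ w, b = u ^ k * w ∧ ε w ≠ 0) ∨ ∃ w, b = u ^ j * w := by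
    intro j
    induction j with
    | zero => exact fun _ => Or.inr ⟨b, by simp⟩
    | succ j ih =>
      intro hj
      rcases ih (by omega) with h | ⟨w, hw⟩
      · exact Or.inl h
      · by_cases h0 : ε w = 0
        · obtain ⟨y, rfl⟩ := hε w h0
          exact Or.inr ⟨y, by rw [hw, pow_succ, mul_assoc]⟩
        · exact Or.inl ⟨j, by omega, w, hw, h0⟩
  rcases h n le_rfl with h | ⟨w, hw⟩
  · exact h
  · exact ⟨n, le_rfl, 1, by rw [hw, hn, zero_mul, zero_mul], by simp⟩

theorem isUnit_of_ne_zero {w : A} (hw : ε w ≠ 0) : IsUnit w := by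
  obtain ⟨y, hy⟩ := exists_eq_algebraMap_add hε w
  rw [hy]
  refine IsNilpotent.isUnit_add_left_of_commute ⟨n, ?_⟩ ((IsUnit.mk0 _ hw).map _)
    (Commute.all _ _)
  rw [mul_pow, hn, zero_mul]

variable (hn' : u ^ (n - 1) ≠ 0)
include hn'

theorem powSum_injective {k : ℕ} (hk : k ≤ n) : Function.Injective (powSum (F := F) u n k) := by
  rw [injective_iff_map_eq_zero]
  induction k with
  | zero => exact fun d _ => Subsingleton.elim _ _
  | succ k ih =>
    intro d hd
    rw [← Fin.snoc_init_self d, powSum_snoc] at hd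
    have h0 : u ^ k * powSum u n k (Fin.init d) = 0 := by
      obtain ⟨y, hy⟩ := pow_dvd_powSum (n := n) u (Fin.init d)
      rw [hy, ← mul_assoc, ← pow_add, Nat.add_sub_cancel' (by omega), hn, zero_mul]
    -- multiplication by `uᵏ` isolates the last coefficient
    have h1 := congrArg (u ^ k * ·) hd
    simp only [mul_add, h0, zero_add, mul_zero, mul_smul_comm, ← pow_add] at h1
    rw [show k + (n - (k + 1)) = n - 1 by omega, smul_eq_zero_iff_left hn'] at h1
    rw [h1, zero_smul, add_zero] at hd
    rw [← Fin.snoc_init_self d, h1, ih (by omega) _ hd]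
    funext i
    refine Fin.lastCases ?_ (fun i => ?_) i <;> simp

theorem pow_mul_eq_zero_iff {k : ℕ} (hk : k ≤ n) (z : A) :
    u ^ k * z = 0 ↔ ∃ d : Fin k → F, z = powSum u n k d := by
  constructor
  · intro hz
    have h : ∀ j ≤ n - k, ∃ y, z = u ^ j * y := by
      intro j
      induction j with
      | zero => exact fun _ => ⟨z, by simp⟩
      | succ j ih =>
        intro hj
        obtain ⟨y, hy⟩ := ih (by omega)
        obtain ⟨y', hy'⟩ := exists_eq_algebraMap_add hε y
        have h0 : ε y • u ^ (n - 1) = 0 := by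
          have h1 : n - 1 = (n - 1 - k - j) + k + j := by omega
          have h3 : u ^ (n - 1) * (u * y') = 0 := by
            rw [← mul_assoc, ← pow_succ, Nat.sub_add_cancel (by omega), hn, zero_mul]
          have h4 : u ^ (n - 1) * y = 0 := by
            rw [h1, pow_add, pow_add, mul_assoc, ← hy, mul_assoc, hz, mul_zero]
          rw [hy', mul_add, h3, add_zero, mul_comm, ← Algebra.smul_def] at h4
          exact h4
        rw [smul_eq_zero_iff_left hn'] at h0
        rw [h0, map_zero, zero_add] at hy'
        exact ⟨y', by rw [hy, hy', pow_succ, mul_assoc]⟩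
    obtain ⟨y, hy⟩ := h _ le_rfl
    obtain ⟨d, hd⟩ := exists_powSum_eq hε hn hk y
    exact ⟨d, by rw [hy, hd]⟩
  · rintro ⟨d, rfl⟩
    obtain ⟨y, hy⟩ := pow_dvd_powSum (n := n) u d
    rw [hy, ← mul_assoc, ← pow_add, Nat.add_sub_cancel' hk, hn, zero_mul]

theorem mul_eq_zero_iff_powSum {k : ℕ} (hk : k ≤ n) {w : A} (hw : ε w ≠ 0) (z : A) :
    u ^ k * w * z = 0 ↔ ∃ d : Fin k → F, z = powSum u n k d := by
  rw [← pow_mul_eq_zero_iff hε hn hn' hk, mul_right_comm,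
    (isUnit_of_ne_zero hε hn hw).mul_left_eq_zero]

variable [Finite F] [Finite A]

theorem card_annihilator {k : ℕ} (hk : k ≤ n) {w : A} (hw : ε w ≠ 0) :
    Nat.card {z // u ^ k * w * z = 0} = Nat.card F ^ k := by
  have h : ∀ d : Fin k → F, u ^ k * w * powSum u n k d = 0 := fun d =>
    (mul_eq_zero_iff_powSum hε hn hn' hk hw _).2 ⟨d, rfl⟩
  have h1 : Function.Bijective
      fun d : Fin k → F => (⟨powSum u n k d, h d⟩ : {z // u ^ k * w * z = 0}) := by
    refine ⟨fun d e hde => powSum_injective hε hn hn' hk (congrArg Subtype.val hde), ?_⟩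
    rintro ⟨z, hz⟩
    obtain ⟨d, rfl⟩ := (mul_eq_zero_iff_powSum hε hn hn' hk hw z).1 hz
    exact ⟨d, rfl⟩
  rw [← Nat.card_eq_of_bijective _ h1, Nat.card_fun, Nat.card_fin]

theorem card_pow_dvd {k : ℕ} (hk : k ≤ n) :
    Nat.card {b : A // u ^ k ∣ b} = Nat.card F ^ (n - k) := by
  have h : ∀ b, u ^ k ∣ b ↔ u ^ (n - k) * 1 * b = 0 := by
    intro b
    rw [mul_eq_zero_iff_powSum hε hn hn' (Nat.sub_le n k) (by simp)]
    constructor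
    · rintro ⟨x, rfl⟩
      obtain ⟨d, hd⟩ := exists_powSum_eq hε hn (Nat.sub_le n k) x
      exact ⟨d, by rw [hd, Nat.sub_sub_self hk]⟩
    · rintro ⟨d, rfl⟩
      have := pow_dvd_powSum (n := n) u d
      rwa [Nat.sub_sub_self hk] at this
  rw [Nat.card_congr (Equiv.subtypeEquivRight h),
    card_annihilator hε hn hn' (Nat.sub_le n k) (by simp)]

/-- The number of pairs with product zero, sorted by the power of `u` in the first factor. -/
theorem card_mul_eq_zero : Nat.card {x : A × A // x.1 * x.2 = 0} =
    Nat.card F ^ n + n * ((Nat.card F - 1) * Nat.card F ^ (n - 1)) := by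
  classical
  have := Fintype.ofFinite A
  have hsum : ∀ m ≤ n, ∑ b : A with u ^ (n - m) ∣ b, Nat.card {z // b * z = 0} =
      Nat.card F ^ n + m * ((Nat.card F - 1) * Nat.card F ^ (n - 1)) := by
    intro m
    induction m with
    | zero =>
      intro _
      have h0 : Finset.univ.filter (fun b : A => u ^ (n - 0) ∣ b) = {0} := by
        ext b
        simp [hn]
      have h1 := card_pow_dvd hε hn hn' (Nat.zero_le n)
      simp only [pow_zero, one_dvd, Nat.sub_zero] at h1
      rw [h0, Finset.sum_singleton, zero_mul, add_zero, ← h1]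
      simp
    | succ m ih =>
      intro hm
      set k := n - (m + 1) with hk
      have hk1 : n - m = k + 1 := by omega
      rw [hk1] at ih
      have hsub : Finset.univ.filter (fun b : A => u ^ (k + 1) ∣ b) ⊆
          Finset.univ.filter (fun b : A => u ^ k ∣ b) := fun b hb => by
        simp only [Finset.mem_filter_univ] at hb ⊢
        exact (pow_dvd_pow u (Nat.le_succ k)).trans hb
      have hcard : ∀ j ≤ n, (Finset.univ.filter (fun b : A => u ^ j ∣ b)).card =
          Nat.card F ^ (n - j) := fun j hj => by
        rw [← card_pow_dvd hε hn hn' hj, Nat.card_eq_fintype_card, Fintype.card_subtype]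
      have hconst : ∀ b ∈ Finset.univ.filter (fun b : A => u ^ k ∣ b) \
          Finset.univ.filter (fun b : A => u ^ (k + 1) ∣ b),
          Nat.card {z // b * z = 0} = Nat.card F ^ k := by
        intro b hb
        simp only [Finset.mem_sdiff, Finset.mem_filter_univ] at hb
        obtain ⟨⟨w, rfl⟩, hb⟩ := hb
        refine card_annihilator hε hn hn' (by omega) fun h => hb ?_
        rw [pow_succ]
        exact mul_dvd_mul_left _ (hε w h)
      rw [← Finset.sum_sdiff hsub, ih (by omega), Finset.sum_congr rfl hconst, Finset.sum_const,
        Finset.card_sdiff_of_subset hsub, hcard k (by omega), hcard (k + 1) (by omega), smul_eq_mul,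
        show n - k = m + 1 by omega, show n - (k + 1) = m by omega, show n - 1 = m + k by omega,
        pow_succ, ← Nat.mul_sub_one, pow_add]
      ring
  have h1 := hsum n le_rfl
  simp only [Nat.sub_self, pow_zero, one_dvd, Finset.filter_true] at h1
  rw [← h1, Nat.card_congr (Equiv.subtypeProdEquivSigmaSubtype fun b z : A => b * z = 0),
    Nat.card_sigma]

end TruncatedPolynomial

section GroupAlgebra

open scoped Transvection

variable {p : ℕ} [Fact p.Prime]

/-! ### The modular group algebra of the cyclic group -/

theorem gpow_eq (i : ℕ) : gpow p i = gpow p 1 ^ i := by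
  rw [gpow, gpow, pow_one, map_pow]

theorem gpow_add (i j : ℕ) : gpow p (i + j) = gpow p j * gpow p i := by
  rw [gpow_eq, gpow_eq i, gpow_eq j, pow_add, mul_comm]

theorem gpow_zero : gpow p 0 = 1 := by
  rw [gpow_eq, pow_zero]

theorem gpow_self : gpow p p = 1 := by
  have h : gen p ^ p = 1 := shear_injective (by
    rw [shear_gen_pow, shear_one, CharP.cast_eq_zero])
  rw [gpow, h, map_one]

theorem euler_gpow (i : ℕ) : euler p (gpow p i) = (i : ZMod p) • gpow p i := by
  rw [gpow, euler_of, shear_gen_pow]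

theorem two_mul_cast_choose_two (i : ℕ) :
    2 * (i.choose 2 : ZMod p) = (i : ZMod p) * i - i := by
  induction i with
  | zero => simp
  | succ i ih =>
    rw [Nat.choose_succ_succ' i 1, Nat.choose_one_right, Nat.cast_add, mul_add, ih]
    push_cast
    ring

theorem chooseTwo_gpow (h2 : (2 : ZMod p) ≠ 0) (i : ℕ) :
    chooseTwo (euler p) (gpow p i) = (i.choose 2 : ZMod p) • gpow p i := by
  rw [chooseTwo_apply, euler_gpow, Derivation.map_smul, euler_gpow, smul_smul, ← sub_smul,
    smul_smul, ← two_mul_cast_choose_two, inv_mul_cancel_left₀ h2]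

/-- The element `∑ aⱼ gʲ` of the group algebra. -/
def ofCoef (a : ℕ → ZMod p) : GrpAlg p := ∑ j ∈ Finset.range p, a j • gpow p j

theorem ofCoef_add (a a' : ℕ → ZMod p) :
    ofCoef (fun j => a j + a' j) = ofCoef a + ofCoef a' := by
  simp only [ofCoef, add_smul, Finset.sum_add_distrib]

theorem ofCoef_smul (r : ZMod p) (a : ℕ → ZMod p) :
    ofCoef (fun j => r * a j) = r • ofCoef a := by
  simp only [ofCoef, mul_smul, Finset.smul_sum]

theorem ofCoef_mul_gpow (a : ℕ → ZMod p) (i : ℕ) :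
    ofCoef a * gpow p i = ∑ j ∈ Finset.range p, a j • gpow p (i + j) := by
  rw [ofCoef, Finset.sum_mul]
  exact Finset.sum_congr rfl fun j _ => by rw [gpow_add, smul_mul_assoc]

theorem euler_ofCoef (a : ℕ → ZMod p) : euler p (ofCoef a) = ofCoef fun j => (j : ZMod p) * a j := by
  rw [ofCoef, map_sum]
  exact Finset.sum_congr rfl fun j _ => by
    rw [Derivation.map_smul, euler_gpow, smul_smul, mul_comm]

theorem chooseTwo_ofCoef (h2 : (2 : ZMod p) ≠ 0) (a : ℕ → ZMod p) :
    chooseTwo (euler p) (ofCoef a) = ofCoef fun j => (j.choose 2 : ZMod p) * a j := by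
  rw [ofCoef, map_sum]
  exact Finset.sum_congr rfl fun j _ => by
    rw [map_smul, chooseTwo_gpow h2, smul_smul, mul_comm]

theorem ofCoef_coef (x : GrpAlg p) : ofCoef (coef x) = x := by
  induction x using MonoidAlgebra.induction_linear with
  | zero => simp [ofCoef, coef]
  | add x y hx hy =>
    change ofCoef (fun j => coef x j + coef y j) = x + y
    rw [ofCoef_add, hx, hy]
  | single h r =>
    rw [ofCoef, Finset.sum_eq_single_of_mem (shear h).val
      (Finset.mem_range.2 (ZMod.val_lt _))]
    · rw [coef, gpow, gen_pow_val, MonoidAlgebra.of_apply, MonoidAlgebra.smul_single]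
      simp
    · intro j hj hne
      have h1 : gen p ^ j ≠ h := by
        rintro rfl
        rw [shear_gen_pow, ZMod.val_cast_of_lt (Finset.mem_range.1 hj)] at hne
        exact hne rfl
      rw [coef, MonoidAlgebra.coeff_single, Finsupp.single_eq_of_ne h1, zero_smul]

variable (p) in
/-- The augmentation of the group algebra. -/
def aug : GrpAlg p →ₐ[ZMod p] ZMod p := MonoidAlgebra.lift (ZMod p) (ZMod p) (Grp p) 1

theorem aug_gpow (i : ℕ) : aug p (gpow p i) = 1 := by
  simp [aug, gpow]

theorem aug_eq_sum (x : GrpAlg p) : aug p x = ∑ j ∈ Finset.range p, coef x j := by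
  conv_lhs => rw [← ofCoef_coef x, ofCoef, map_sum]
  exact Finset.sum_congr rfl fun j _ => by rw [map_smul, aug_gpow, smul_eq_mul, mul_one]

variable (p) in
/-- The nilpotent element `1 - g⁻¹`. -/
def unip : GrpAlg p := 1 - gpow p (p - 1)

theorem gpow_pred_mul : gpow p (p - 1) * gpow p 1 = 1 := by
  rw [← gpow_add, Nat.add_sub_cancel' (Fact.out : p.Prime).one_le, gpow_self]

theorem gpow_one_sub_one : gpow p 1 - 1 = unip p * gpow p 1 := by
  rw [unip, sub_mul, gpow_pred_mul, one_mul]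

theorem unip_dvd {x : GrpAlg p} (hx : aug p x = 0) : unip p ∣ x := by
  have h : x = ∑ j ∈ Finset.range p, coef x j • (gpow p j - 1) := by
    simp only [smul_sub, Finset.sum_sub_distrib]
    rw [← Finset.sum_smul, ← aug_eq_sum, hx, zero_smul, sub_zero]
    exact (ofCoef_coef x).symm
  rw [h]
  refine Finset.dvd_sum fun j _ => ?_
  rw [← mul_smul_one, mul_comm, gpow_eq]
  refine Dvd.dvd.mul_left ?_ _
  exact (Dvd.intro _ gpow_one_sub_one.symm).trans (sub_one_dvd_pow_sub_one _ _)

theorem unip_pow : unip p ^ p = 0 := by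
  have : CharP (GrpAlg p) p := charP_of_injective_algebraMap
    (algebraMap (ZMod p) (GrpAlg p)).injective p
  rw [unip, sub_pow_char, one_pow, gpow_eq, ← pow_mul, mul_comm, pow_mul, ← gpow_eq, gpow_self,
    one_pow, sub_self]

theorem card_grpAlg : Nat.card (GrpAlg p) = p ^ p := by
  have h := Nat.card_congr
    ((MonoidAlgebra.coeffLinearEquiv (ZMod p) :
      GrpAlg p ≃ₗ[ZMod p] (Grp p →₀ ZMod p)).toEquiv.trans
      Finsupp.equivFunOnFinite)
  rw [h, Nat.card_fun, Nat.card_congr (shearEquiv p), Nat.card_zmod]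

instance : Finite (GrpAlg p) := Nat.finite_of_card_ne_zero (by
  rw [card_grpAlg]
  exact pow_ne_zero _ (Fact.out : p.Prime).ne_zero)

/-- If `uᵖ⁻¹ = 0`, then the powers `uᵐ` with `m < p - 1` would span the group algebra, which has
dimension `p`. -/
theorem unip_pow_ne_zero : unip p ^ (p - 1) ≠ 0 := by
  intro h
  have hs : Function.Surjective (powSum (F := ZMod p) (unip p) (p - 1) (p - 1)) := fun x => by
    obtain ⟨d, hd⟩ := exists_powSum_eq (ε := aug p) (fun _ => unip_dvd) h le_rfl x
    exact ⟨d, by rw [hd, Nat.sub_self, pow_zero, one_mul]⟩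
  have h1 := Nat.card_le_card_of_surjective _ hs
  rw [card_grpAlg, Nat.card_fun, Nat.card_zmod, Nat.card_fin] at h1
  have hp := (Fact.out : p.Prime)
  exact absurd h1 (not_le.2 (Nat.pow_lt_pow_right hp.one_lt (Nat.sub_lt hp.pos one_pos)))

theorem hasOrder_iff {b : GrpAlg p} {k : ℕ} :
    HasOrder b k ↔ ∃ w, b = unip p ^ k * w ∧ aug p w ≠ 0 := by
  constructor
  · rintro ⟨w, rfl, hw⟩
    refine ⟨gpow p 1 ^ k * w, by rw [gpow_one_sub_one, mul_pow, mul_assoc], ?_⟩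
    rwa [map_mul, map_pow, aug_gpow, one_pow, one_mul, aug_eq_sum]
  · rintro ⟨w, rfl, hw⟩
    refine ⟨gpow p (p - 1) ^ k * w, ?_, ?_⟩
    · rw [← mul_assoc, ← mul_pow, gpow_one_sub_one, mul_assoc (unip p), mul_comm (gpow p 1),
        gpow_pred_mul, mul_one]
    · rwa [← aug_eq_sum, map_mul, map_pow, aug_gpow, one_pow, one_mul]

/-- The powers of `1 - g⁻¹` in the basis of group elements. -/
theorem unip_pow_eq {N : ℕ} (hN : N < p) : unip p ^ N =
    1 + ofCoef fun j => (-1) ^ (p - j) * (N.choose (p - j) : ZMod p) := by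
  have h1 : unip p ^ N =
      ∑ i ∈ Finset.range (p + 1), ((-1) ^ i * (N.choose i : ZMod p)) • gpow p (p - i) := by
    rw [unip, sub_eq_neg_add, add_pow]
    rw [← Finset.sum_subset (Finset.range_subset_range.2 (by omega : N + 1 ≤ p + 1))]
    · refine Finset.sum_congr rfl fun i hi => ?_
      have h : gpow p (p - 1) ^ i = gpow p (p - i) := by
        have hi' : i ≤ p := by have := Finset.mem_range.1 hi; omega
        have hu : IsUnit (gpow p i) := IsUnit.of_mul_eq_one (gpow p (p - i)) (by
          rw [← gpow_add, Nat.sub_add_cancel hi', gpow_self])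
        refine hu.mul_right_cancel ?_
        rw [← gpow_add, Nat.add_sub_cancel' hi', gpow_self, gpow_eq i, ← mul_pow, gpow_pred_mul,
          one_pow]
      rw [one_pow, mul_one, neg_pow, h, Algebra.smul_def, map_mul, map_pow, map_neg, map_one,
        map_natCast]
      ring
    · intro i _ hi
      rw [Nat.choose_eq_zero_of_lt (by simpa using hi)]
      simp
  rw [h1, ← Finset.sum_range_reflect, Finset.sum_range_succ, add_comm, ofCoef]
  congr 1
  · simp [gpow_self]
  · refine Finset.sum_congr rfl fun j hj => ?_
    have := Finset.mem_range.1 hj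
    rw [show p + 1 - 1 - j = p - j by omega, Nat.sub_sub_self this.le]

end GroupAlgebra

section Data

open scoped Transvection

variable {p : ℕ} [Fact p.Prime]

/-! ### Parameter functions given by the data -/

/-- The scalar `∑ (-1)ᵐ⁺¹ dₘ`. -/
def altSum {k : ℕ} (d : Fin k → ZMod p) : ZMod p := ∑ m : Fin k, (-1) ^ (m : ℕ) * d m

/-- The annihilator of `b` contains the element with coordinates `(-1)ᵐ⁺¹ dₘ`, and `μ(d, j)` are
its coefficients. -/
theorem powSum_unip {k : ℕ} (hk : k ≤ p) (d : Fin k → ZMod p) :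
    powSum (unip p) p k (fun m => (-1) ^ (m : ℕ) * d m) = altSum d • 1 + ofCoef (mu d) := by
  have h : ∀ m : Fin k, unip p ^ (p - (m + 1)) = 1 + ofCoef fun j =>
      (-1) ^ (p - j) * ((p - (m + 1)).choose (p - j) : ZMod p) := fun m =>
    unip_pow_eq (by omega)
  rw [powSum_apply, altSum, Finset.sum_smul]
  simp only [h, smul_add, Finset.sum_add_distrib]
  congr 1
  simp only [ofCoef, Finset.smul_sum, smul_smul]
  rw [Finset.sum_comm]
  refine Finset.sum_congr rfl fun j _ => ?_
  rw [← Finset.sum_smul, mu, Finset.mul_sum]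
  congr 1
  exact Finset.sum_congr rfl fun m _ => by ring

theorem mu_zero {k : ℕ} (d : Fin k → ZMod p) : mu d 0 = 0 := by
  have hp := (Fact.out : p.Prime).pos
  rw [mu, Finset.sum_eq_zero, mul_zero]
  intro m _
  rw [Nat.choose_eq_zero_of_lt (by omega)]
  simp

/-- The coefficients `C(j+1, 2) bⱼ + μ(d, j)`. -/
def dataCoef (b : GrpAlg p) {k : ℕ} (d : Fin k → ZMod p) (j : ℕ) : ZMod p :=
  ((j + 1).choose 2 : ZMod p) * coef b j + mu d j

theorem euler_ofCoef_dataCoef (b : GrpAlg p) {k : ℕ} (d : Fin k → ZMod p) :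
    euler p (ofCoef fun j => (j : ZMod p) ^ (p - 2) * dataCoef b d j) = ofCoef (dataCoef b d) := by
  rw [euler_ofCoef, ofCoef, ofCoef]
  refine Finset.sum_congr rfl fun j hj => ?_
  congr 1
  rcases Nat.eq_zero_or_pos j with rfl | h0
  · simp [dataCoef, mu_zero]
  · have hj' : (j : ZMod p) ≠ 0 := by
      rw [Ne, ZMod.natCast_eq_zero_iff]
      exact Nat.not_dvd_of_pos_of_lt h0 (Finset.mem_range.1 hj)
    have h2 := (Fact.out : p.Prime).two_le
    -- Fermat's little theorem
    rw [← mul_assoc, ← pow_succ', show p - 2 + 1 = p - 1 by omega,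
      ZMod.pow_card_sub_one_eq_one hj', one_mul]

/-- This uses `C(j, 2) + j = C(j+1, 2)`. -/
theorem chooseTwo_add_euler (h2 : (2 : ZMod p) ≠ 0) (b : GrpAlg p) :
    chooseTwo (euler p) b + euler p b =
      ofCoef fun j => ((j + 1).choose 2 : ZMod p) * coef b j := by
  conv_lhs => rw [← ofCoef_coef b, chooseTwo_ofCoef h2, euler_ofCoef, ← ofCoef_add]
  congr 1
  funext j
  rw [Nat.choose_succ_succ' j 1, Nat.choose_one_right, Nat.cast_add]
  ring

/-- The element `c` of the standard parameter functions given by the data, for `φ = f(v₁)`. -/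
def dataC (b : GrpAlg p) {k : ℕ} (d : Fin k → ZMod p) (φ : GrpAlg p) : GrpAlg p :=
  ofCoef (fun j => (j : ZMod p) ^ (p - 2) * dataCoef b d j) - φ

/-- The element `α` of the standard parameter functions given by the data, for `φ = f(v₁)`. -/
def dataA {k : ℕ} (d : Fin k → ZMod p) (φ : GrpAlg p) : GrpAlg p :=
  altSum d • 1 + euler p φ

/-- The element which has to annihilate `b` is the one with coordinates `(-1)ᵐ⁺¹ dₘ`. -/
theorem data_condition (hp : p ≠ 2) (b : GrpAlg p) {k : ℕ} (hk : k ≤ p) (d : Fin k → ZMod p)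
    (φ : GrpAlg p) :
    dataA d φ + euler p (dataC b d φ) - chooseTwo (euler p) b - euler p b =
      powSum (unip p) p k (fun m => (-1) ^ (m : ℕ) * d m) := by
  have h : ofCoef (dataCoef b d) =
      (chooseTwo (euler p) b + euler p b) + ofCoef (mu d) := by
    rw [chooseTwo_add_euler (two_ne_zero_zmod hp), ← ofCoef_add]
    rfl
  rw [powSum_unip hk, dataA, dataC, map_sub, euler_ofCoef_dataCoef, h]
  abel

theorem isGivenBy_stdParams (hp : p ≠ 2) (b : GrpAlg p) {k : ℕ} (d : Fin k → ZMod p)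
    (f : Plane p →ₗ[ZMod p] GrpAlg p) (κC : GrpAlg p) :
    IsGivenBy (stdParams b (dataC b d (f (v₁ p))) (dataA d (f (v₁ p))) κC) b d f κC where
  lam_v₁ i _ := by
    rw [stdParams_lam, euler_gpow]
    simp [v₁]
  lam_v₂ i _ := by
    have h1 : ∑ j ∈ Finset.range p,
        (((i.choose 2 : ZMod p) + i * (j : ZMod p) ^ (p - 2) * ((j + 1).choose 2 : ZMod p)) *
          coef b j) • gpow p (i + j)
      + (i : ZMod p) • ∑ j ∈ Finset.range p, ((j : ZMod p) ^ (p - 2) * mu d j) • gpow p (i + j) =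
        ((i.choose 2 : ZMod p) • ofCoef (coef b) + (i : ZMod p) •
          ofCoef (fun j => (j : ZMod p) ^ (p - 2) * dataCoef b d j)) * gpow p i := by
      rw [← ofCoef_mul_gpow, ← ofCoef_mul_gpow, ← smul_mul_assoc, ← add_mul, ← ofCoef_smul,
        ← ofCoef_smul, ← ofCoef_smul, ← ofCoef_add, ← ofCoef_add]
      congr 2
      funext j
      rw [dataCoef]
      ring
    have h3 : ∑ j ∈ Finset.range p, coef (f (v₁ p)) j • gpow p j = f (v₁ p) := ofCoef_coef _
    rw [h1, h3, stdParams_lam, euler_gpow, chooseTwo_gpow (two_ne_zero_zmod hp), ofCoef_coef, dataC]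
    simp only [v₂, Pi.single_eq_same, one_smul, mul_smul_comm, add_mul, sub_mul, smul_mul_assoc,
      smul_sub]
    simp
    abel
  kap_self v := by
    rw [stdParams_kap, mul_comm, sub_self, zero_smul]
  kap_v₁_v₂ := by
    have h1 : ∑ j ∈ Finset.range p, ((j : ZMod p) * coef b j) • (v₂ p ⊗ₜ[ZMod p] gpow p j) =
        v₂ p ⊗ₜ euler p b := by
      conv_rhs => rw [← ofCoef_coef b, euler_ofCoef, ofCoef, TensorProduct.tmul_sum]
      exact Finset.sum_congr rfl fun j _ => (TensorProduct.tmul_smul _ _ _).symm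
    have h3 : ∑ j ∈ Finset.range p, ((j : ZMod p) * coef (f (v₁ p)) j) •
        (v₁ p ⊗ₜ[ZMod p] gpow p j) = v₁ p ⊗ₜ euler p (f (v₁ p)) := by
      conv_rhs => rw [← ofCoef_coef (f (v₁ p)), euler_ofCoef, ofCoef, TensorProduct.tmul_sum]
      exact Finset.sum_congr rfl fun j _ => (TensorProduct.tmul_smul _ _ _).symm
    rw [h1, h3, stdParams_kap, dataA, TensorProduct.tmul_add, TensorProduct.tmul_smul, gpow_zero,
      add_right_comm]
    simp [v₁, v₂, altSum]

theorem IsGivenBy.unique {P Q : Params (ZMod p) (Plane p) (Grp p)} {b : GrpAlg p} {k : ℕ}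
    {d : Fin k → ZMod p} {f : Plane p →ₗ[ZMod p] GrpAlg p} {κC : GrpAlg p}
    (hP : IsGivenBy P b d f κC) (hQ : IsGivenBy Q b d f κC) : P = Q := by
  have hswap : ∀ {R : Params (ZMod p) (Plane p) (Grp p)}, IsGivenBy R b d f κC →
      R.kap (v₂ p) (v₁ p) = -R.kap (v₁ p) (v₂ p) := fun {R} hR => by
    have h := hR.kap_self (v₁ p + v₂ p)
    simp only [map_add, LinearMap.add_apply, hR.kap_self, zero_add, add_zero] at h
    exact eq_neg_of_add_eq_zero_left h
  refine Params.ext (LinearMap.ext₂ fun a v => ?_) (LinearMap.ext₂ fun v w => ?_)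
  · rw [plane_eq v, ← ofCoef_coef a, ofCoef]
    simp only [map_sum, map_smul, map_add, LinearMap.sum_apply, LinearMap.smul_apply]
    congr 2 <;> refine Finset.sum_congr rfl fun j hj => ?_
    · rw [hP.lam_v₁ j (Finset.mem_range.1 hj), hQ.lam_v₁ j (Finset.mem_range.1 hj)]
    · rw [hP.lam_v₂ j (Finset.mem_range.1 hj), hQ.lam_v₂ j (Finset.mem_range.1 hj)]
  · rw [plane_eq v, plane_eq w]
    simp only [map_add, map_smul, LinearMap.add_apply, LinearMap.smul_apply, hP.kap_self,
      hQ.kap_self, hswap hP, hswap hQ, hP.kap_v₁_v₂, hQ.kap_v₁_v₂]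

end Data

section Counting

open scoped Transvection

variable {p : ℕ} [Fact p.Prime]

/-! ### Classification and count -/

theorem annihilates_iff {b : GrpAlg p} {k : ℕ} (hk : k ≤ p) (hb : HasOrder b k) (z : GrpAlg p) :
    b * z = 0 ↔ ∃ d : Fin k → ZMod p, z = powSum (unip p) p k d := by
  obtain ⟨w, rfl, hw⟩ := hasOrder_iff.1 hb
  exact mul_eq_zero_iff_powSum (fun _ => unip_dvd) unip_pow unip_pow_ne_zero hk hw z

theorem IsGivenBy.isDrinfeldOrbifoldAlgebra (hp : p ≠ 2) {P : Params (ZMod p) (Plane p) (Grp p)}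
    {b : GrpAlg p} {k : ℕ} (hk : k ≤ p) (hb : HasOrder b k) {d : Fin k → ZMod p}
    {f : Plane p →ₗ[ZMod p] GrpAlg p} {κC : GrpAlg p} (hP : IsGivenBy P b d f κC) :
    IsDrinfeldOrbifoldAlgebra P := by
  rw [hP.unique (isGivenBy_stdParams hp b d f κC)]
  refine isDrinfeldOrbifoldAlgebra_stdParams κC (two_ne_zero_zmod hp) ?_
  rw [data_condition hp b hk]
  exact (annihilates_iff hk hb _).2 ⟨_, rfl⟩

theorem exists_isGivenBy (hp : p ≠ 2) {P : Params (ZMod p) (Plane p) (Grp p)}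
    (hP : IsDrinfeldOrbifoldAlgebra P) :
    ∃ k ≤ p, ∃ b : GrpAlg p, HasOrder b k ∧ ∃ (d : Fin k → ZMod p)
      (f : Plane p →ₗ[ZMod p] GrpAlg p) (κC : GrpAlg p), IsGivenBy P b d f κC := by
  obtain ⟨b, c, α, κC, rfl, hcond⟩ := exists_eq_stdParams hP (two_ne_zero_zmod hp)
  obtain ⟨k, hk, w, hw⟩ := exists_eq_pow_mul (ε := aug p) (fun _ => unip_dvd) unip_pow b
  have hb : HasOrder b k := hasOrder_iff.2 ⟨w, hw⟩
  obtain ⟨d', hd'⟩ := (annihilates_iff hk hb _).1 hcond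
  obtain ⟨d, rfl⟩ : ∃ d : Fin k → ZMod p, d' = fun m : Fin k => (-1) ^ (m : ℕ) * d m :=
    ⟨fun m : Fin k => (-1) ^ (m : ℕ) * d' m, by
      funext m
      rw [← mul_assoc, ← mul_pow, neg_one_mul, neg_neg, one_pow, one_mul]⟩
  -- the value `f(v₁)` is determined by `c`, and `f(v₂)` is arbitrary
  let φ : GrpAlg p := ofCoef (fun j => (j : ZMod p) ^ (p - 2) * dataCoef b d j) - c
  let f : Plane p →ₗ[ZMod p] GrpAlg p :=
    (LinearMap.proj 0 : Plane p →ₗ[ZMod p] ZMod p).smulRight φ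
  have hf : f (v₁ p) = φ := by simp [f, v₁]
  have hc : dataC b d φ = c := sub_sub_cancel _ _
  have hα : dataA d φ = α := by
    rw [← data_condition hp b hk d φ, hc, sub_left_inj, sub_left_inj, add_left_inj] at hd'
    exact hd'.symm
  refine ⟨k, hk, b, hb, d, f, κC, ?_⟩
  have h := isGivenBy_stdParams hp b d f κC
  rwa [hf, hc, hα] at h

/-- The parameters `b`, `c`, `κ^C` and `z = α + E(c) - ½ E(E - 1)(b) - E(b)`, where `b z = 0`,
give the parameter functions of all Drinfeld orbifold algebras. -/
def paramsOf (x : {x : GrpAlg p × GrpAlg p // x.1 * x.2 = 0} × GrpAlg p × GrpAlg p) :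
    Params (ZMod p) (Plane p) (Grp p) :=
  stdParams x.1.1.1 x.2.1
    (x.1.1.2 - euler p x.2.1 + chooseTwo (euler p) x.1.1.1 + euler p x.1.1.1) x.2.2

theorem stdParams_injective {b c α κC b' c' α' κC' : GrpAlg p}
    (h : stdParams b c α κC = stdParams b' c' α' κC') :
    b = b' ∧ c = c' ∧ α = α' ∧ κC = κC' := by
  obtain ⟨g, hg, hE⟩ : ∃ g : GrpAlg p, g = MonoidAlgebra.of (ZMod p) (Grp p) (gen p) ∧
    euler p g = g := ⟨_, rfl, by rw [euler_of, shear_gen, one_smul]⟩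
  have hq : chooseTwo (euler p) g = 0 := by rw [chooseTwo_apply, hE, hE, sub_self, smul_zero]
  have hcancel : ∀ x y : GrpAlg p, x * g = y * g → x = y := fun x y hxy => by
    refine sub_eq_zero.1 (of_gen_mul_right_cancel ?_)
    rw [← hg, mul_comm, sub_mul, hxy, sub_self]
  have h1 := congrArg (fun P : Params (ZMod p) (Plane p) (Grp p) => P.lam g (v₁ p)) h
  have h2 := congrArg (fun P : Params (ZMod p) (Plane p) (Grp p) => P.lam g (v₂ p)) h
  have h3 := congrArg (fun P : Params (ZMod p) (Plane p) (Grp p) => P.kap (v₁ p) (v₂ p)) h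
  simp only [stdParams_lam, stdParams_kap, hE, hq, v₁, v₂, Pi.single_eq_same, one_smul, mul_zero,
    zero_add, mul_one, sub_zero, ne_eq, one_ne_zero, zero_ne_one, not_false_eq_true,
    Pi.single_eq_of_ne, zero_smul, add_zero, Prod.mk.injEq] at h1 h2 h3
  refine ⟨hcancel _ _ h1, hcancel _ _ h2, ?_, h3.1⟩
  have h4 := congrArg (tensorCoord p 0) h3.2
  simpa [tensorCoord_tmul] using h4

theorem bijOn_paramsOf (h2 : (2 : ZMod p) ≠ 0) :
    Set.BijOn (paramsOf (p := p)) Set.univ {P | IsDrinfeldOrbifoldAlgebra P} := by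
  refine ⟨?_, ?_, ?_⟩
  · rintro ⟨⟨⟨b, z⟩, hbz⟩, c, κC⟩ _
    refine isDrinfeldOrbifoldAlgebra_stdParams κC h2 ?_
    refine Eq.trans ?_ hbz
    ring
  · rintro ⟨⟨⟨b, z⟩, hbz⟩, c, κC⟩ _ ⟨⟨⟨b', z'⟩, hbz'⟩, c', κC'⟩ _ h
    obtain ⟨h1, h2, h3, h4⟩ := stdParams_injective h
    dsimp only at h1 h2 h3 h4
    subst h1 h2 h4
    rw [add_left_inj, add_left_inj, sub_left_inj] at h3
    subst h3
    rfl
  · intro P hP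
    obtain ⟨b, c, α, κC, rfl, hcond⟩ := exists_eq_stdParams hP h2
    refine ⟨⟨⟨⟨b, _⟩, hcond⟩, c, κC⟩, trivial, ?_⟩
    rw [paramsOf]
    congr 1
    ring

theorem ncard_isDrinfeldOrbifoldAlgebra (hp : p ≠ 2) :
    {P : Params (ZMod p) (Plane p) (Grp p) | IsDrinfeldOrbifoldAlgebra P}.ncard =
      p ^ (3 * p + 1) := by
  have h := bijOn_paramsOf (two_ne_zero_zmod hp)
  have h1 := card_mul_eq_zero (ε := aug p) (fun _ => unip_dvd) unip_pow unip_pow_ne_zero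
  have h3 : (p - 1) * p ^ (p - 1) * p + p ^ p = p ^ p * p := by
    obtain ⟨q, rfl⟩ : ∃ q, p = q + 1 := ⟨p - 1, (Nat.succ_pred_prime Fact.out).symm⟩
    rw [Nat.add_sub_cancel]
    ring
  rw [← h.image_eq, h.injOn.ncard_image, Set.ncard_univ, Nat.card_prod,
    Nat.card_prod, h1, card_grpAlg, Nat.card_zmod, add_comm, mul_comm p, h3]
  ring

end Counting

end DrinfeldOrbifold

end

theorem mainTheorem2 (p : ℕ) [Fact p.Prime] (hp : p ≠ 2) :
    -- there are exactly `p ^ (3 p + 1)` pairs of parameter functions `(λ, κ)` for which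
    -- `H_{λ,κ}` is a Drinfeld orbifold algebra
    {P : Params (ZMod p) (Plane p) (Grp p) | IsDrinfeldOrbifoldAlgebra P}.ncard =
        p ^ (3 * p + 1) ∧
    -- different pairs define different quotients of the free algebra
    Set.InjOn (fun P : Params (ZMod p) (Plane p) (Grp p) => RingHom.ker (toH P))
      {P | IsDrinfeldOrbifoldAlgebra P} ∧
    -- every choice of data determines parameter functions, which give a Drinfeld orbifold algebra
    (∀ k ≤ p, ∀ b : GrpAlg p, HasOrder b k → ∀ (d : Fin k → ZMod p)
      (f : Plane p →ₗ[ZMod p] GrpAlg p) (κC : GrpAlg p),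
        (∃! P : Params (ZMod p) (Plane p) (Grp p), IsGivenBy P b d f κC) ∧
        ∀ P : Params (ZMod p) (Plane p) (Grp p),
          IsGivenBy P b d f κC → IsDrinfeldOrbifoldAlgebra P) ∧
    -- and every Drinfeld orbifold algebra arises in this way
    (∀ P : Params (ZMod p) (Plane p) (Grp p), IsDrinfeldOrbifoldAlgebra P →
      ∃ k ≤ p, ∃ b : GrpAlg p, HasOrder b k ∧ ∃ (d : Fin k → ZMod p)
        (f : Plane p →ₗ[ZMod p] GrpAlg p) (κC : GrpAlg p), IsGivenBy P b d f κC) := by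
  exact ⟨ncard_isDrinfeldOrbifoldAlgebra hp, injOn_ker_toH, fun k hk b hb d f κC =>
    ⟨⟨_, isGivenBy_stdParams hp b d f κC, fun P hP => hP.unique (isGivenBy_stdParams hp b d f κC)⟩,
      fun P hP => hP.isDrinfeldOrbifoldAlgebra hp hk hb⟩, fun P hP => exists_isGivenBy hp hP⟩
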